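/- Let $X$ and $U$ be complex Banach spaces, and let $A$ be the generator of a $C_0$-semigroup $T=(T(t))_{t\ge 0}$ on $X$ that is exponentially stable (its growth bound $\omega(T)=\inf\{\omega:\exists M\,\forall t\ge 0\ \|T(t)\|\le Me^{\omega t}\}$ is negative) and analytic of some angle $\theta\in(0,\pi/2]$: writing $S_\phi=\{z\in\mathbb{C}\setminus\{0\}:|\operatorname{Arg} z|<\phi\}$, $T$ extends to an analytic map $S_\theta\to\mathcal{L}(X)$ which is strongly continuous at $0$ (with value $I$ there) on $S_{\theta'}$ for every $\theta'\in(0,\theta)$. Write $R(z,A)=(zI-A)^{-1}$. Fix $s\in\rho(A)$ and let $X_{-1}$ be the completion of $X$ in the norm $\|R(s,A)x\|_X$; $T(t)$ extends continuously to $X_{-1}$ and the extension is again denoted by $T(t)$. Fix $\phi\in(\pi/2-\theta,\pi/2]$ with $\sigma(-A)\subset S_\phi$ (for example $\phi=\pi/2$). For $\alpha\in(0,1)$ let $$(-A)^{-\alpha}=\frac{1}{2\pi i}\int_{\partial S_\phi} z^{-\alpha}R(z,-A)\,dz,$$ with $\partial S_\phi$ oriented counterclockwise and $z^{-\alpha}$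 the principal branch, and let $X_{-\alpha}$ be the completion of $X$ in the norm $\|(-A)^{-\alpha}x\|_X$, regarded as a subspace of $X_{-1}$ through the continuous extension $X_{-\alpha}\to X_{-1}$ of the identity of $X$. For $p\in[1,\infty]$, an operator $B\in\mathcal{L}(U,X_{-1})$ is called finite-time $L^p$-admissible if for every $t\ge 0$ there is $C>0$ such that for every $u\in L^p([0,t],U)$ the Bochner integral $\int_0^t T(t-r)Bu(r)\,dr$ in $X_{-1}$ is an element of $X$ and $$\Big\|\int_0^t T(t-r)Bu(r)\,dr\Big\|_X\le C\,\|u\|_{L^p([0,t],U)}.$$ Let $B\in\mathcal{L}(U,X_{-1})$ and $\beta\in(0,1)$. Then the following are equivalent: (a) $B$ is finite-time $L^p$-admissible for every $p\in\big(\frac{1}{1-\beta},\infty\big]$; (b) for every $\alpha\in(\beta,1)$, $B$ is a bounded map from $U$ into $X_{-\alpha}$. -/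

import Mathlib

open Filter Topology MeasureTheory Set
open scoped ENNReal

noncomputable section

namespace LinearPMap

variable {X : Type*} [NormedAddCommGroup X] [NormedSpace ℂ X]

/-- `R` is a bounded two-sided inverse of `z I - A : D(A) → X`. -/
def IsResolventAt (A : X →ₗ.[ℂ] X) (z : ℂ) (R : X →L[ℂ] X) : Prop :=
  (∀ x : X, ∃ h : R x ∈ A.domain, z • R x - A ⟨R x, h⟩ = x) ∧
    ∀ y : A.domain, R (z • (y : X) - A y) = y

/-- The resolvent set `ρ(A)` of an unbounded operator `A : X ⊇ D(A) → X`. -/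
def resolventSet (A : X →ₗ.[ℂ] X) : Set ℂ :=
  {z | ∃ R : X →L[ℂ] X, A.IsResolventAt z R}

open Classical in
/-- The resolvent `R(z, A) = (z I - A)⁻¹`, a bounded operator on `X`
(with the value `0` for `z` outside `ρ(A)`). -/
def resolvent (A : X →ₗ.[ℂ] X) (z : ℂ) : X →L[ℂ] X :=
  if h : z ∈ A.resolventSet then h.choose else 0

/-- The spectrum `σ(A) = ℂ \ ρ(A)`. -/
def spectrumSet (A : X →ₗ.[ℂ] X) : Set ℂ := (A.resolventSet)ᶜ

end LinearPMap

/-- The open sector `S_φ = {z ≠ 0 : |Arg z| < φ}` around the positive real half-line. -/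
def openSector (φ : ℝ) : Set ℂ := {z | z ≠ 0 ∧ |z.arg| < φ}

/-! ### Fractional powers and extrapolation spaces -/

section Spaces

variable {X : Type*} [NormedAddCommGroup X] [NormedSpace ℂ X]

/-- The fractional power `(-A)^{-α} = (2πi)⁻¹ ∫_γ z^{-α} R(z, -A) dz`, where `γ = ∂S_φ` is the
boundary of the sector `S_φ`, counterclockwise: it comes in from infinity along the ray
`arg z = φ` and goes out to infinity along the ray `arg z = -φ`; `z^{-α}` is the principal branch.
The integral is a Bochner integral in the space of bounded operators on `X`. -/
def negFracPow (A : X →ₗ.[ℂ] X) (φ α : ℝ) : X →L[ℂ] X :=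
  (2 * (Real.pi : ℂ) * Complex.I)⁻¹ •
    ((∫ r in Ioi (0 : ℝ),
        (((r : ℂ) * Complex.exp (-(φ : ℂ) * Complex.I)) ^ (-(α : ℂ)) *
            Complex.exp (-(φ : ℂ) * Complex.I)) •
          (-A).resolvent ((r : ℂ) * Complex.exp (-(φ : ℂ) * Complex.I))) -
      ∫ r in Ioi (0 : ℝ),
        (((r : ℂ) * Complex.exp ((φ : ℂ) * Complex.I)) ^ (-(α : ℂ)) *
            Complex.exp ((φ : ℂ) * Complex.I)) •
          (-A).resolvent ((r : ℂ) * Complex.exp ((φ : ℂ) * Complex.I)))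

/-- A copy of the vector space `X`, to be normed by `x ↦ ‖J x‖`. -/
def Renormed (_J : X →L[ℂ] X) : Type _ := X

namespace Renormed

variable (J : X →L[ℂ] X)

instance : AddCommGroup (Renormed J) := inferInstanceAs (AddCommGroup X)

instance : Module ℂ (Renormed J) := inferInstanceAs (Module ℂ X)

/-- The identity map from `X` to its copy. -/
def of : X ≃ₗ[ℂ] Renormed J := LinearEquiv.refl ℂ X

/-- The operator `J`, as a linear map on the copy of `X`. -/
def toX : Renormed J →ₗ[ℂ] X := (J : X →ₗ[ℂ] X) ∘ₗ ((of J).symm : Renormed J →ₗ[ℂ] X)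

instance : SeminormedAddCommGroup (Renormed J) :=
  SeminormedAddCommGroup.induced (Renormed J) X (toX J)

instance : NormedSpace ℂ (Renormed J) := NormedSpace.induced ℂ (Renormed J) X (toX J)

theorem norm_of (x : X) : ‖of J x‖ = ‖J x‖ := rfl

/-- A bounded operator on `X` that commutes with `J`, acting on the renormed space. -/
def liftOp (S : X →L[ℂ] X) (h : ∀ x, J (S x) = S (J x)) : Renormed J →L[ℂ] Renormed J :=
  LinearMap.mkContinuous
    ((of J : X →ₗ[ℂ] Renormed J) ∘ₗ (S : X →ₗ[ℂ] X) ∘ₗ ((of J).symm : Renormed J →ₗ[ℂ] X)) ‖S‖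
    (fun x => by
      change ‖J (S ((of J).symm x))‖ ≤ ‖S‖ * ‖J ((of J).symm x)‖
      rw [h]
      exact S.le_opNorm _)

end Renormed

/-- The completion of `X` with respect to the norm `x ↦ ‖J x‖` (`J` injective and bounded). -/
abbrev Extrapolated (J : X →L[ℂ] X) : Type _ := UniformSpace.Completion (Renormed J)

namespace Extrapolated

/-- The canonical map of `X` into its completion with respect to `x ↦ ‖J x‖`. -/
def of (J : X →L[ℂ] X) : X →L[ℂ] Extrapolated J :=
  (UniformSpace.Completion.toComplL : Renormed J →L[ℂ] Extrapolated J) ∘L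
    LinearMap.mkContinuous (Renormed.of J : X →ₗ[ℂ] Renormed J) ‖J‖ (fun x => J.le_opNorm x)

/-- The continuous extension to the completion of an operator that commutes with `J`. -/
def extendOp (J S : X →L[ℂ] X) (h : ∀ x, J (S x) = S (J x)) :
    Extrapolated J →L[ℂ] Extrapolated J :=
  (Renormed.liftOp J S h).completion

theorem norm_of (J : X →L[ℂ] X) (x : X) : ‖of J x‖ = ‖J x‖ :=
  UniformSpace.Completion.norm_coe (Renormed.of J x)

theorem extendOp_of (J S : X →L[ℂ] X) (h : ∀ x, J (S x) = S (J x)) (x : X) :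
    extendOp J S h (of J x) = of J (S x) :=
  ContinuousLinearMap.completion_apply_coe (Renormed.liftOp J S h) (Renormed.of J x)

end Extrapolated

/-- The extrapolation space `X_{-1}`: the completion of `X` in the norm `‖(s I - A)⁻¹ x‖`. -/
abbrev ExtrapolationSpace (A : X →ₗ.[ℂ] X) (s : ℂ) : Type _ := Extrapolated (A.resolvent s)

/-- The space `X_{-α}`: the completion of `X` in the norm `‖(-A)^{-α} x‖`. -/
abbrev FractionalSpace (A : X →ₗ.[ℂ] X) (φ α : ℝ) : Type _ := Extrapolated (negFracPow A φ α)

/-- `B : U → X_{-1}` is a bounded map into `X_{-α}`: it factors as `B = ι ∘ B'` with `B'` bounded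
from `U` to `X_{-α}` and `ι : X_{-α} → X_{-1}` the continuous extension of the identity of `X`
(which is unique, as `X` is dense in `X_{-α}`). -/
def MapsBoundedlyIntoFractional {U : Type*} [NormedAddCommGroup U] [NormedSpace ℂ U]
    (A : X →ₗ.[ℂ] X) (s : ℂ) (B : U →L[ℂ] ExtrapolationSpace A s) (φ α : ℝ) : Prop :=
  ∃ ι : FractionalSpace A φ α →L[ℂ] ExtrapolationSpace A s,
    (∀ x : X, ι (Extrapolated.of (negFracPow A φ α) x) = Extrapolated.of (A.resolvent s) x) ∧
      ∃ B' : U →L[ℂ] FractionalSpace A φ α, ∀ u : U, ι (B' u) = B u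

end Spaces

/-! ### Strongly continuous semigroups -/

/-- A `C₀`-semigroup `(T(t))_{t ≥ 0}` of bounded operators on `X`. The values of `toFun` at negative
times carry no information and are never used. -/
structure C0Semigroup (X : Type*) [NormedAddCommGroup X] [NormedSpace ℂ X] where
  toFun : ℝ → X →L[ℂ] X
  map_zero : toFun 0 = ContinuousLinearMap.id ℂ X
  map_add : ∀ s t : ℝ, 0 ≤ s → 0 ≤ t → toFun (s + t) = toFun s ∘L toFun t
  tendsto_zero : ∀ x : X, Tendsto (fun t => toFun t x) (𝓝[>] 0) (𝓝 x)

namespace C0Semigroup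

variable {X : Type*} [NormedAddCommGroup X] [NormedSpace ℂ X] (T : C0Semigroup X)

instance : CoeFun (C0Semigroup X) (fun _ => ℝ → X →L[ℂ] X) := ⟨C0Semigroup.toFun⟩

/-- `(T(t) x - x) / t → y` as `t → 0+`. -/
def HasGeneratorValue (x y : X) : Prop :=
  Tendsto (fun t : ℝ => t⁻¹ • (T t x - x)) (𝓝[>] 0) (𝓝 y)

variable {T} in
theorem HasGeneratorValue.unique {x y z : X} (h : T.HasGeneratorValue x y)
    (h' : T.HasGeneratorValue x z) : y = z := tendsto_nhds_unique h h'

variable {T} in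
theorem HasGeneratorValue.add {x y x' y' : X} (h : T.HasGeneratorValue x y)
    (h' : T.HasGeneratorValue x' y') : T.HasGeneratorValue (x + x') (y + y') := by
  refine (Tendsto.add h h').congr fun t => ?_
  rw [← smul_add, ContinuousLinearMap.map_add]
  congr 1
  abel

variable {T} in
theorem HasGeneratorValue.smul {x y : X} (c : ℂ) (h : T.HasGeneratorValue x y) :
    T.HasGeneratorValue (c • x) (c • y) := by
  refine (Tendsto.const_smul h c).congr fun t => ?_
  rw [smul_comm, map_smul, smul_sub]

variable {T} in
theorem HasGeneratorValue.map {x y : X} (h : T.HasGeneratorValue x y) {t : ℝ} (ht : 0 ≤ t) :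
    T.HasGeneratorValue (T t x) (T t y) := by
  refine (((T t).continuous.tendsto y).comp h).congr' ?_
  filter_upwards [self_mem_nhdsWithin] with r hr
  have h1 : T r (T t x) = T t (T r x) := by
    rw [← ContinuousLinearMap.comp_apply, ← ContinuousLinearMap.comp_apply,
      ← T.map_add r t (le_of_lt hr) ht, ← T.map_add t r ht (le_of_lt hr), add_comm]
  rw [Function.comp_apply, h1, ← map_sub]
  exact (T t).map_smul_of_tower r⁻¹ (T r x - x)

/-- The generator of `T`: `A x = lim_{t → 0+} (T(t) x - x) / t`, on the domain of all `x` for which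
the limit exists. -/
def generator : X →ₗ.[ℂ] X where
  domain :=
    { carrier := {x | ∃ y, T.HasGeneratorValue x y}
      add_mem' := fun ⟨_, h⟩ ⟨_, h'⟩ => ⟨_, h.add h'⟩
      zero_mem' := ⟨0, by
        refine (tendsto_const_nhds (x := (0 : X))).congr fun t => ?_
        simp⟩
      smul_mem' := fun c _ ⟨_, h⟩ => ⟨_, h.smul c⟩ }
  toFun :=
    { toFun := fun x => Classical.choose x.2
      map_add' := fun x y =>
        (Classical.choose_spec (x + y).2).unique
          ((Classical.choose_spec x.2).add (Classical.choose_spec y.2))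
      map_smul' := fun c x =>
        (Classical.choose_spec (c • x).2).unique ((Classical.choose_spec x.2).smul c) }

theorem hasGeneratorValue_generator (x : T.generator.domain) :
    T.HasGeneratorValue (x : X) (T.generator x) :=
  Classical.choose_spec x.2

theorem resolvent_comm (s : ℂ) {t : ℝ} (ht : 0 ≤ t) (x : X) :
    T.generator.resolvent s (T t x) = T t (T.generator.resolvent s x) := by
  unfold LinearPMap.resolvent
  split_ifs with h
  · obtain ⟨h1, h2⟩ := h.choose_spec
    set R := h.choose
    obtain ⟨hx, hx'⟩ := h1 x
    have hv := (T.hasGeneratorValue_generator ⟨R x, hx⟩).map ht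
    have hmem : T t (R x) ∈ T.generator.domain := ⟨_, hv⟩
    have h3 := h2 ⟨T t (R x), hmem⟩
    rw [(T.hasGeneratorValue_generator ⟨T t (R x), hmem⟩).unique hv] at h3
    rw [← hx', map_sub, map_smul, hx']
    exact h3
  · simp

/-- The growth bound `ω(T) = inf {ω : ∃ M, ∀ t ≥ 0, ‖T(t)‖ ≤ M e^{ω t}} ∈ [-∞, ∞]`. -/
def growthBound : EReal :=
  sInf {w : EReal | ∃ ω : ℝ, w = ω ∧ ∃ M : ℝ, ∀ t : ℝ, 0 ≤ t → ‖T t‖ ≤ M * Real.exp (ω * t)}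

/-- Exponential stability: `ω(T) < 0`. -/
def IsExponentiallyStable : Prop := T.growthBound < 0

/-- `T` is an analytic semigroup of angle `θ ∈ (0, π/2]`: it extends to an analytic map
`S_θ → L(X)` that is strongly continuous at `0` on every smaller sector. -/
def IsAnalyticOfAngle (θ : ℝ) : Prop :=
  0 < θ ∧ θ ≤ Real.pi / 2 ∧ ∃ F : ℂ → X →L[ℂ] X,
    AnalyticOnNhd ℂ F (openSector θ) ∧ (∀ t : ℝ, 0 < t → F (t : ℂ) = T t) ∧
      ∀ θ' : ℝ, 0 < θ' → θ' < θ → ∀ x : X,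
        Tendsto (fun z => F z x) (𝓝[openSector θ'] 0) (𝓝 x)

open Classical in
/-- The operators `T(t)`, `t ≥ 0`, extended continuously to `X_{-1}`
(with the value `0` at negative times). -/
def extrapolated (s : ℂ) (t : ℝ) :
    ExtrapolationSpace T.generator s →L[ℂ] ExtrapolationSpace T.generator s :=
  if ht : 0 ≤ t then
    Extrapolated.extendOp (T.generator.resolvent s) (T t) (fun x => T.resolvent_comm s ht x)
  else 0

/-- Finite-time `L^p`-admissibility of `B ∈ L(U, X_{-1})`: for every `t ≥ 0` there is `C > 0` such
that for all `u ∈ L^p([0, t], U)` the Bochner integral `∫_0^t T(t - r) B u(r) dr` in `X_{-1}` is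
the image of an element `x` of `X` with `‖x‖_X ≤ C ‖u‖_{L^p([0, t], U)}`. -/
def IsFiniteTimeAdmissible {U : Type*} [NormedAddCommGroup U] [NormedSpace ℂ U] (s : ℂ)
    (B : U →L[ℂ] ExtrapolationSpace T.generator s) (p : ℝ≥0∞) : Prop :=
  ∀ t : ℝ, 0 ≤ t → ∃ C : ℝ, 0 < C ∧
    ∀ u : ℝ → U, MemLp u p (volume.restrict (Icc 0 t)) →
      IntegrableOn (fun r => T.extrapolated s (t - r) (B (u r))) (Icc 0 t) ∧
        ∃ x : X,
          Extrapolated.of (T.generator.resolvent s) x =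
              ∫ r in Icc 0 t, T.extrapolated s (t - r) (B (u r)) ∧
            ‖x‖ ≤ C * (eLpNorm u p (volume.restrict (Icc 0 t))).toReal

end C0Semigroup

end

/-! Write J = (-A)^{-α}. The proof rests on two real-variable formulas. First, J is a nonzero
multiple of ∫_0^∞ t^{α-1} T(t) dt (`negFracPow_eq_integral`): the contour ∂S_φ is rotated onto the
negative half-line, which gives Balakrishnan's integral of r^{-α} R(r, A), and R(r, A) is then
replaced by the Laplace transform of T. Second, a scaled copy K of ∫_0^∞ r^{-α} T(r) dr satisfies K
J = R(0, A) = (-A)^{-1} (`integral_mul_integral`). Since T(t) = -R(0, A) T'(t), it follows that T(t)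
= -T'(t) K J, and the analytic estimate ‖T'(t)‖ ≤ C/t yields ‖T'(t) K‖ ≤ C t^{-α}
(`exists_factorization`). In other words, T(t) maps X_{-α} into X with norm O(t^{-α}).

(b) ⇒ (a): given p with conjugate exponent q, choose α between β and 1/q. The kernel (t - r)^{-α}
then lies in L^q(0, t), and Hölder's inequality bounds the integral of T(t - r) B u(r) in X.

(a) ⇒ (b): given α, choose p between 1/(1-β) and 1/(1-α). The input r ↦ (1 - r)^{α-1} u lies in
L^p(0, 1), and admissibility at time 1 puts ∫_0^1 t^{α-1} T(t) B u dt in X with a bound C ‖u‖. The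
part over (1, ∞) lies in X because the semigroup smooths. Hence b = (-A)^{-α} B is bounded from U to
X. Membership of B u in the completion X_{-α} also needs approximation by elements of X, and these
are the T(t) B u as t → 0+.

Completions are handled inside X: `Extrapolated.realize` is the isometric extension of J,
respectively R(s, A), so statements about X_{-α} and X_{-1} become identities between bounded
operators on X. -/

namespace LinearPMap

/-! ### Algebra and continuity of the resolvent -/

variable {X : Type*} [NormedAddCommGroup X] [NormedSpace ℂ X] {A : X →ₗ.[ℂ] X}

theorem isResolventAt_resolvent {z : ℂ} (h : z ∈ A.resolventSet) :
    A.IsResolventAt z (A.resolvent z) := by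
  unfold LinearPMap.resolvent
  rw [dif_pos h]
  exact h.choose_spec

theorem IsResolventAt.unique {z : ℂ} {R S : X →L[ℂ] X} (hR : A.IsResolventAt z R)
    (hS : A.IsResolventAt z S) : R = S := by
  ext x
  obtain ⟨h, hx⟩ := hS.1 x
  have := hR.2 ⟨S x, h⟩
  rwa [hx] at this

theorem IsResolventAt.resolvent_eq {z : ℂ} {R : X →L[ℂ] X} (hR : A.IsResolventAt z R) :
    A.resolvent z = R :=
  (isResolventAt_resolvent ⟨R, hR⟩).unique hR

theorem IsResolventAt.neg {z : ℂ} {R : X →L[ℂ] X} (hR : A.IsResolventAt z R) :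
    (-A).IsResolventAt (-z) (-R) := by
  refine ⟨fun x => ?_, fun y => ?_⟩
  · obtain ⟨h, hx⟩ := hR.1 x
    have h' : -(R x) ∈ A.domain := A.domain.neg_mem h
    refine ⟨h', ?_⟩
    have : A ⟨-(R x), h'⟩ = -A ⟨R x, h⟩ := by
      rw [← A.map_neg]; rfl
    have h3 : (-A) ⟨-(R x), h'⟩ = -(A ⟨-(R x), h'⟩) := rfl
    change (-z) • (-(R x)) - (-A) ⟨-(R x), h'⟩ = x
    rw [h3, this, neg_neg, neg_smul_neg]
    exact hx
  · have h := hR.2 y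
    have h3 : (-A) y = -(A y) := rfl
    change -(R ((-z) • (y : X) - (-A) y)) = y
    rw [h3, ← _root_.map_neg]
    convert h using 2
    rw [neg_smul]
    abel

theorem mem_resolventSet_of_neg {z : ℂ} (h : z ∈ (-A).resolventSet) : -z ∈ A.resolventSet := by
  obtain ⟨R, hR⟩ := h
  have := hR.neg
  rw [neg_neg] at this
  exact ⟨-R, this⟩

theorem resolvent_neg {z : ℂ} (h : -z ∈ A.resolventSet) :
    (-A).resolvent z = -A.resolvent (-z) := by
  have := (isResolventAt_resolvent h).neg
  rw [neg_neg] at this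
  exact this.resolvent_eq

theorem resolvent_sub_resolvent {z w : ℂ} (hz : z ∈ A.resolventSet) (hw : w ∈ A.resolventSet) :
    A.resolvent z - A.resolvent w = (w - z) • (A.resolvent z * A.resolvent w) := by
  ext x
  obtain ⟨h, hx⟩ := (isResolventAt_resolvent hw).1 x
  have h2 := (isResolventAt_resolvent hz).2 ⟨A.resolvent w x, h⟩
  have h3 : z • A.resolvent w x - A ⟨A.resolvent w x, h⟩ = (z - w) • A.resolvent w x + x := by
    nth_rw 4 [← hx]
    rw [sub_smul]
    abel
  simp only at h2
  rw [h3, _root_.map_add, _root_.map_smul] at h2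
  simp only [_root_.sub_apply, _root_.smul_apply,
    mul_apply_eq_comp]
  nth_rw 1 [← h2]
  rw [sub_smul, sub_smul]
  abel

theorem resolvent_commute {z w : ℂ} (hz : z ∈ A.resolventSet) (hw : w ∈ A.resolventSet) :
    Commute (A.resolvent z) (A.resolvent w) := by
  rcases eq_or_ne z w with rfl | h
  · exact Commute.refl _
  · have h1 := resolvent_sub_resolvent hz hw
    have h2 := resolvent_sub_resolvent hw hz
    have h3 : (w - z) • (A.resolvent z * A.resolvent w) =
        (w - z) • (A.resolvent w * A.resolvent z) := by
      rw [← h1, ← neg_sub, h2, ← neg_smul, neg_sub]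
    exact smul_right_injective _ (sub_ne_zero.2 h.symm) h3

theorem resolvent_injective {z : ℂ} (hz : z ∈ A.resolventSet) :
    Function.Injective (A.resolvent z) := by
  intro x y hxy
  obtain ⟨h, hx⟩ := (isResolventAt_resolvent hz).1 x
  obtain ⟨h', hy⟩ := (isResolventAt_resolvent hz).1 y
  rw [← hx, ← hy]
  congr 1
  · rw [hxy]
  · congr 2

/-- The resolvent identity R(w) = R(z) + (z - w) R(w) R(z) bounds ‖R(w)‖ by ‖R(z)‖ + ‖R(w)‖/2, and
the last term is absorbed. -/
theorem norm_resolvent_le {z w : ℂ} (hz : z ∈ A.resolventSet) (hw : w ∈ A.resolventSet)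
    (h : ‖w - z‖ * ‖A.resolvent z‖ ≤ 1 / 2) :
    ‖A.resolvent w‖ ≤ 2 * ‖A.resolvent z‖ := by
  have h1 : A.resolvent w = A.resolvent z + (z - w) • (A.resolvent w * A.resolvent z) := by
    rw [← resolvent_sub_resolvent hw hz]
    abel
  have h2 : ‖A.resolvent w‖ ≤ ‖A.resolvent z‖ + ‖z - w‖ * (‖A.resolvent w‖ * ‖A.resolvent z‖) := by
    nth_rw 1 [h1]
    refine (norm_add_le _ _).trans ?_
    rw [norm_smul]
    gcongr
    exact norm_mul_le _ _
  rw [norm_sub_rev] at h2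
  nlinarith [norm_nonneg (A.resolvent w), norm_nonneg (A.resolvent z)]

theorem continuousOn_resolvent : ContinuousOn A.resolvent A.resolventSet := by
  intro z hz
  have h1 : Tendsto (fun w => ‖z - w‖ * (2 * ‖A.resolvent z‖ * ‖A.resolvent z‖))
      (𝓝[A.resolventSet] z) (𝓝 0) := by
    have : Continuous fun w : ℂ => ‖z - w‖ * (2 * ‖A.resolvent z‖ * ‖A.resolvent z‖) := by fun_prop
    simpa using (this.tendsto z).mono_left nhdsWithin_le_nhds
  have h2 : ∀ᶠ w in 𝓝[A.resolventSet] z, ‖w - z‖ * ‖A.resolvent z‖ ≤ 1 / 2 := by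
    have : Continuous fun w : ℂ => ‖w - z‖ * ‖A.resolvent z‖ := by fun_prop
    have h3 : Tendsto (fun w : ℂ => ‖w - z‖ * ‖A.resolvent z‖) (𝓝[A.resolventSet] z) (𝓝 0) := by
      simpa using (this.tendsto z).mono_left nhdsWithin_le_nhds
    exact h3.eventually_le_const (by norm_num)
  refine tendsto_iff_norm_sub_tendsto_zero.2 ?_
  refine squeeze_zero' (Eventually.of_forall fun _ => norm_nonneg _) ?_ h1
  filter_upwards [h2, self_mem_nhdsWithin] with w hw hw'
  rw [resolvent_sub_resolvent hw' hz, norm_smul]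
  gcongr
  refine (norm_mul_le _ _).trans ?_
  gcongr
  exact norm_resolvent_le hz hw' hw

/-- A derivative within the resolvent set is enough, since it is only composed with curves that stay
there; openness of the resolvent set is never needed. -/
theorem hasDerivWithinAt_resolvent {z : ℂ} (hz : z ∈ A.resolventSet) :
    HasDerivWithinAt A.resolvent (-(A.resolvent z * A.resolvent z)) A.resolventSet z := by
  rw [hasDerivWithinAt_iff_tendsto_slope]
  have h1 : Tendsto (fun w => -(A.resolvent w * A.resolvent z)) (𝓝[A.resolventSet \ {z}] z)
      (𝓝 (-(A.resolvent z * A.resolvent z))) :=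
    (((continuousOn_resolvent z hz).mono_left (nhdsWithin_mono _ sdiff_subset)).mul_const _).neg
  refine h1.congr' ?_
  filter_upwards [self_mem_nhdsWithin] with w hw
  have hne : w - z ≠ 0 := sub_ne_zero.2 hw.2
  rw [slope_def_module, resolvent_sub_resolvent hw.1 hz, smul_smul, ← neg_sub w z, mul_neg,
    inv_mul_cancel₀ hne, neg_one_smul]

end LinearPMap

/-! ### Geometry of sectors -/

theorem isPreconnected_openSector {φ : ℝ} (hφ : φ ≤ Real.pi) : IsPreconnected (openSector φ) := by
  have h1 : openSector φ = Complex.exp '' (Complex.im ⁻¹' Ioo (-φ) φ) := by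
    ext z
    constructor
    · rintro ⟨h0, h⟩
      refine ⟨Complex.log z, ?_, Complex.exp_log h0⟩
      rw [mem_preimage, Complex.log_im]
      exact abs_lt.1 h
    · rintro ⟨w, hw, rfl⟩
      refine ⟨Complex.exp_ne_zero w, ?_⟩
      rw [Complex.arg_exp, (toIocMod_eq_self Real.two_pi_pos).2]
      · exact abs_lt.2 hw
      · exact ⟨by linarith [hw.1], by linarith [hw.2]⟩
  rw [h1]
  exact (((convex_Ioo (-φ) φ).linear_preimage Complex.imLm).isPreconnected).image _
    Complex.continuous_exp.continuousOn

theorem ofReal_mem_openSector {φ t : ℝ} (hφ : 0 < φ) (ht : 0 < t) : (t : ℂ) ∈ openSector φ := by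
  refine ⟨by exact_mod_cast ht.ne', ?_⟩
  rw [Complex.arg_ofReal_of_nonneg ht.le, abs_zero]
  exact hφ

theorem smul_mem_openSector {φ t : ℝ} (ht : 0 < t) {z : ℂ} (hz : z ∈ openSector φ) :
    (t : ℂ) * z ∈ openSector φ := by
  refine ⟨mul_ne_zero (by exact_mod_cast ht.ne') hz.1, ?_⟩
  rw [Complex.arg_real_mul _ ht]
  exact hz.2

theorem exp_mul_I_mem_openSector {φ η : ℝ} (hφ : φ ≤ Real.pi) (hη : |η| < φ) :
    Complex.exp (η * Complex.I) ∈ openSector φ := by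
  refine ⟨Complex.exp_ne_zero _, ?_⟩
  rw [abs_lt] at hη
  rw [Complex.arg_exp_mul_I, (toIocMod_eq_self Real.two_pi_pos).2]
  · exact abs_lt.2 hη
  · exact ⟨by linarith [hη.1], by linarith [hη.2]⟩

/-- Balls around positive reals `t` of radius comparable to `t` are contained in a sector. -/
theorem exists_closedBall_subset_openSector {φ : ℝ} (hφ : 0 < φ) :
    ∃ ε : ℝ, 0 < ε ∧ ε < 1 ∧ ∀ t : ℝ, 0 < t → Metric.closedBall (t : ℂ) (ε * t) ⊆ openSector φ := by
  have h1 : ∀ᶠ z : ℂ in 𝓝 1, z ∈ openSector φ := by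
    have h2 : ContinuousAt (fun z : ℂ => |z.arg|) 1 :=
      (Complex.continuousAt_arg Complex.one_mem_slitPlane).abs
    have h3 : ∀ᶠ z : ℂ in 𝓝 1, |z.arg| < φ :=
      h2.eventually_lt continuousAt_const (by simpa using hφ)
    filter_upwards [h3, eventually_ne_nhds one_ne_zero] with z hz hz'
    exact ⟨hz', hz⟩
  obtain ⟨ε, hε, h⟩ := Metric.eventually_nhds_iff_ball.1 h1
  refine ⟨min (ε / 2) (1 / 2), by positivity, (min_le_right _ _).trans_lt (by norm_num), ?_⟩
  intro t ht z hz
  have ht' : (t : ℂ) ≠ 0 := by exact_mod_cast ht.ne'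
  have h4 : z / t ∈ Metric.ball (1 : ℂ) ε := by
    rw [mem_closedBall_iff_norm] at hz
    rw [mem_ball_iff_norm]
    have : z / t - 1 = (z - t) / t := by field_simp
    rw [this, norm_div, Complex.norm_real, Real.norm_of_nonneg ht.le, div_lt_iff₀ ht]
    refine hz.trans_lt ?_
    gcongr
    exact (min_le_left _ _).trans_lt (by linarith)
  have := smul_mem_openSector ht (h _ h4)
  rwa [mul_div_cancel₀ _ ht'] at this

/-! ### Smoothing by an analytic semigroup -/

namespace C0Semigroup

variable {X : Type*} [NormedAddCommGroup X] [NormedSpace ℂ X] {T : C0Semigroup X}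

theorem mul_eq (T : C0Semigroup X) {s t : ℝ} (hs : 0 ≤ s) (ht : 0 ≤ t) :
    T s * T t = T (s + t) := (T.map_add s t hs ht).symm

theorem IsExponentiallyStable.exists_norm_le (h : T.IsExponentiallyStable) :
    ∃ M ω : ℝ, 0 < M ∧ 0 < ω ∧ ∀ t : ℝ, 0 ≤ t → ‖T t‖ ≤ M * Real.exp (-ω * t) := by
  obtain ⟨w, ⟨ω, rfl, M, hM⟩, hw⟩ := sInf_lt_iff.1 h
  refine ⟨max M 1, -ω, by positivity, by simpa using hw, fun t ht => (hM t ht).trans ?_⟩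
  rw [neg_neg]
  gcongr
  exact le_max_left _ _

theorem resolvent_commute (T : C0Semigroup X) (z : ℂ) {t : ℝ} (ht : 0 ≤ t) :
    Commute (T.generator.resolvent z) (T t) :=
  ContinuousLinearMap.ext fun x => T.resolvent_comm z ht x

theorem generator_eq {x y : X} (h : T.HasGeneratorValue x y) :
    T.generator ⟨x, ⟨y, h⟩⟩ = y :=
  (T.hasGeneratorValue_generator ⟨x, ⟨y, h⟩⟩).unique h

/-- `F` is an analytic extension of `T` to the sector of half-angle `θ`. -/
structure IsAnalyticExtension (T : C0Semigroup X) (θ : ℝ) (F : ℂ → X →L[ℂ] X) : Prop where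
  pos : 0 < θ
  le : θ ≤ Real.pi / 2
  analytic : AnalyticOnNhd ℂ F (openSector θ)
  eq : ∀ t : ℝ, 0 < t → F (t : ℂ) = T t
  tendsto : ∀ θ' : ℝ, 0 < θ' → θ' < θ → ∀ x : X,
    Tendsto (fun z => F z x) (𝓝[openSector θ'] 0) (𝓝 x)

namespace IsAnalyticExtension

variable {θ : ℝ} {F : ℂ → X →L[ℂ] X}

theorem lt_pi (h : T.IsAnalyticExtension θ F) : θ < Real.pi :=
  h.le.trans_lt (by linarith [Real.pi_pos])

theorem hasDerivAt (h : T.IsAnalyticExtension θ F) {t : ℝ} (ht : 0 < t) :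
    HasDerivAt T.toFun (deriv F t) t := by
  have h1 : HasDerivAt (fun r : ℝ => F r) ((1 : ℂ) • deriv F t) t :=
    (h.analytic _ (ofReal_mem_openSector h.pos ht)).differentiableAt.hasDerivAt.scomp t
      Complex.ofRealCLM.hasDerivAt
  rw [one_smul] at h1
  refine h1.congr_of_eventuallyEq ?_
  filter_upwards [eventually_gt_nhds ht] with r hr
  exact (h.eq r hr).symm

theorem continuousOn (h : T.IsAnalyticExtension θ F) : ContinuousOn T.toFun (Ioi 0) :=
  fun _ ht => (h.hasDerivAt ht).continuousAt.continuousWithinAt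

theorem continuousOn_deriv [CompleteSpace X] (h : T.IsAnalyticExtension θ F) :
    ContinuousOn (fun t : ℝ => deriv F t) (Ioi 0) := fun _ ht =>
  ((h.analytic.deriv _ (ofReal_mem_openSector h.pos ht)).continuousAt.comp
    Complex.continuous_ofReal.continuousAt).continuousWithinAt

/-- This is the semigroup law differentiated in its first time. It transfers the decay of T to T',
and later turns T'(t) ∫ r^{-α} T(r) dr into an integral of T'(t + r). -/
theorem deriv_add (h : T.IsAnalyticExtension θ F) {t s : ℝ} (ht : 0 < t) (hs : 0 ≤ s) :
    deriv F ((t + s : ℝ) : ℂ) = deriv F t * T s := by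
  have h1 : HasDerivAt (fun r => T (r + s)) (deriv F ((t + s : ℝ) : ℂ)) t :=
    (h.hasDerivAt (by linarith : 0 < t + s)).comp_add_const t s
  have h2 : HasDerivAt (fun r => T r * T s) (deriv F t * T s) t := (h.hasDerivAt ht).mul_const _
  refine h1.unique (h2.congr_of_eventuallyEq ?_)
  filter_upwards [eventually_gt_nhds ht] with r hr
  exact (T.mul_eq hr.le hs).symm

/-- Operators commuting with the semigroup commute with its derivative. -/
theorem commute_deriv (h : T.IsAnalyticExtension θ F) {S : X →L[ℂ] X}
    (hS : ∀ t : ℝ, 0 ≤ t → Commute S (T t)) {t : ℝ} (ht : 0 < t) : Commute S (deriv F t) := by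
  have h1 : HasDerivAt (fun r => S * T r) (S * deriv F t) t := (h.hasDerivAt ht).const_mul _
  have h2 : HasDerivAt (fun r => T r * S) (deriv F t * S) t := (h.hasDerivAt ht).mul_const _
  refine h1.unique (h2.congr_of_eventuallyEq ?_)
  filter_upwards [eventually_gt_nhds ht] with r hr
  exact hS r hr.le

theorem hasGeneratorValue (h : T.IsAnalyticExtension θ F) {t : ℝ} (ht : 0 < t) (x : X) :
    T.HasGeneratorValue (T t x) (deriv F t x) := by
  have h1 : HasDerivAt (fun r => T r x) (deriv F t x) t :=
    ((ContinuousLinearMap.apply ℂ X x).restrictScalars ℝ).hasFDerivAt.comp_hasDerivAt t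
      (h.hasDerivAt ht)
  have h2 := h1.tendsto_slope_zero_right
  refine h2.congr' ?_
  filter_upwards [self_mem_nhdsWithin] with r hr
  rw [add_comm, ← T.mul_eq (le_of_lt hr) ht.le]
  rfl

/-- This is A T(t) = T'(t) in bounded form, with (-A)^{-1} applied to both sides. -/
theorem eq_neg_resolvent_mul_deriv_ofReal (h : T.IsAnalyticExtension θ F)
    (h0 : 0 ∈ T.generator.resolventSet) {t : ℝ} (ht : 0 < t) :
    T t = -(T.generator.resolvent 0 * deriv F t) := by
  ext x
  have h1 := h.hasGeneratorValue ht x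
  have h2 := (LinearPMap.isResolventAt_resolvent h0).2 ⟨T t x, ⟨_, h1⟩⟩
  rw [generator_eq h1, zero_smul, zero_sub, map_neg] at h2
  exact h2.symm

/-- Both sides are analytic on the connected sector and agree at real points accumulating at 1, so
the identity theorem applies. No complex semigroup law for F is required. -/
theorem eq_neg_resolvent_mul_deriv [CompleteSpace X] (h : T.IsAnalyticExtension θ F)
    (h0 : 0 ∈ T.generator.resolventSet) {z : ℂ} (hz : z ∈ openSector θ) :
    F z = -(T.generator.resolvent 0 * deriv F z) := by
  have h1 : AnalyticOnNhd ℂ (fun z => -(T.generator.resolvent 0 * deriv F z)) (openSector θ) :=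
    fun w hw => (analyticAt_const.mul (h.analytic.deriv w hw)).neg
  refine h.analytic.eqOn_of_preconnected_of_frequently_eq h1
    (isPreconnected_openSector h.lt_pi.le) (ofReal_mem_openSector h.pos one_pos) ?_ hz
  have h2 : Tendsto (fun t : ℝ => (t : ℂ)) (𝓝[>] 1) (𝓝[≠] ((1 : ℝ) : ℂ)) := by
    refine tendsto_nhdsWithin_iff.2
      ⟨(Complex.continuous_ofReal.tendsto 1).mono_left nhdsWithin_le_nhds, ?_⟩
    filter_upwards [self_mem_nhdsWithin] with t ht
    simpa using ne_of_gt ht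
  refine h2.frequently (Eventually.frequently ?_)
  filter_upwards [self_mem_nhdsWithin] with t ht
  have ht' : 0 < t := one_pos.trans ht
  rw [h.eq t ht', ← h.eq_neg_resolvent_mul_deriv_ofReal h0 ht']

/-- Otherwise some z_n → 0 in the smaller sector would have ‖F(z_n)‖ unbounded, although F(z_n) x
converges for every x; this contradicts uniform boundedness. -/
theorem exists_norm_le [CompleteSpace X] (h : T.IsAnalyticExtension θ F) {θ' : ℝ} (h1 : 0 < θ')
    (h2 : θ' < θ) :
    ∃ M δ : ℝ, 0 < M ∧ 0 < δ ∧ ∀ z ∈ openSector θ', ‖z‖ < δ → ‖F z‖ ≤ M := by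
  by_contra! hcon
  have h3 : ∀ n : ℕ, ∃ z ∈ openSector θ', ‖z‖ < 1 / ((n : ℝ) + 1) ∧ (n : ℝ) + 1 < ‖F z‖ := fun n =>
    hcon _ _ (by positivity) (by positivity)
  choose z hz hz1 hz2 using h3
  have h4 : Tendsto z atTop (𝓝[openSector θ'] 0) := by
    refine tendsto_nhdsWithin_iff.2 ⟨?_, Eventually.of_forall hz⟩
    exact squeeze_zero_norm (fun n => (hz1 n).le) tendsto_one_div_add_atTop_nhds_zero_nat
  obtain ⟨C, hC⟩ := banach_steinhaus (g := fun n => F (z n)) fun x => by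
    obtain ⟨C, hC⟩ := ((h.tendsto θ' h1 h2 x).comp h4).norm.bddAbove_range
    exact ⟨C, fun n => hC ⟨n, rfl⟩⟩
  obtain ⟨n, hn⟩ := exists_nat_gt C
  linarith [hC n, hz2 n]

/-- For small t this is Cauchy's estimate on a disc about t of radius proportional to t. For large
t, T'(t) = T'(τ) T(t - τ) decays exponentially, which is better than 1/t. -/
theorem exists_norm_deriv_le [CompleteSpace X] (h : T.IsAnalyticExtension θ F)
    (hT : T.IsExponentiallyStable) :
    ∃ C : ℝ, 0 < C ∧ ∀ t : ℝ, 0 < t → ‖deriv F t‖ ≤ C / t := by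
  obtain ⟨M, δ, hM, hδ, hF⟩ := h.exists_norm_le (half_pos h.pos) (half_lt_self h.pos)
  obtain ⟨ε, hε, hε1, hball⟩ := exists_closedBall_subset_openSector (half_pos h.pos)
  obtain ⟨N, ω, hN, hω, hTN⟩ := hT.exists_norm_le
  have hsmall : ∀ t : ℝ, 0 < t → t < δ / 2 → ‖deriv F t‖ ≤ M / ε / t := by
    intro t ht htδ
    rw [div_div]
    refine Complex.norm_deriv_le_of_forall_mem_sphere_norm_le (by positivity) ?_ ?_
    · refine DifferentiableOn.diffContOnCl fun w hw => ?_
      rw [closure_ball _ (by positivity)] at hw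
      have h5 := hball t ht hw
      exact (h.analytic w ⟨h5.1, h5.2.trans (half_lt_self h.pos)⟩).differentiableAt.differentiableWithinAt
    · intro w hw
      refine hF w (hball t ht (Metric.sphere_subset_closedBall hw)) ?_
      rw [mem_sphere_iff_norm] at hw
      calc ‖w‖ = ‖(w - t) + t‖ := by simp
        _ ≤ ‖w - t‖ + ‖(t : ℂ)‖ := norm_add_le _ _
        _ = ε * t + t := by rw [hw, Complex.norm_real, Real.norm_of_nonneg ht.le]
        _ < δ := by nlinarith
  set τ := δ / 4 with hτ
  have hτ0 : 0 < τ := by positivity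
  have hτ1 := hsmall τ hτ0 (by rw [hτ]; linarith)
  refine ⟨M / ε + M / ε / τ * N * (τ + 1 / ω), by positivity, fun t ht => ?_⟩
  rcases lt_or_ge t (δ / 2) with h6 | h6
  · refine (hsmall t ht h6).trans ?_
    gcongr
    exact le_add_of_nonneg_right (by positivity)
  · have h7 : 0 ≤ t - τ := by rw [hτ]; linarith
    have h8 : deriv F t = deriv F τ * T (t - τ) := by
      rw [← h.deriv_add hτ0 h7, add_sub_cancel]
    have h9 : Real.exp (-ω * (t - τ)) * t ≤ τ + 1 / ω := by
      have h10 : ω * (t - τ) + 1 ≤ Real.exp (ω * (t - τ)) := Real.add_one_le_exp _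
      have h11 : t ≤ (τ + 1 / ω) * Real.exp (ω * (t - τ)) := by
        have : (τ + 1 / ω) * (ω * (t - τ) + 1) ≤ (τ + 1 / ω) * Real.exp (ω * (t - τ)) := by gcongr
        refine le_trans ?_ this
        have h12 : (τ + 1 / ω) * (ω * (t - τ) + 1) = t + τ * ω * (t - τ) + 1 / ω := by
          field_simp
          ring
        rw [h12]
        have : 0 ≤ τ * ω * (t - τ) := by positivity
        have : 0 < 1 / ω := by positivity
        linarith
      rw [neg_mul, Real.exp_neg, inv_mul_le_iff₀ (Real.exp_pos _)]
      linarith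
    rw [h8, le_div_iff₀ ht]
    calc ‖deriv F τ * T (t - τ)‖ * t ≤ (M / ε / τ * (N * Real.exp (-ω * (t - τ)))) * t := by
          gcongr
          exact (norm_mul_le _ _).trans (mul_le_mul hτ1 (hTN _ h7) (norm_nonneg _) (by positivity))
      _ = M / ε / τ * N * (Real.exp (-ω * (t - τ)) * t) := by ring
      _ ≤ M / ε / τ * N * (τ + 1 / ω) := by gcongr
      _ ≤ _ := le_add_of_nonneg_left (by positivity)

/-- The derivative of `e^{-λ r e} R(λ, A) F(r e)` along a ray in the sector. -/
theorem hasDerivAt_resolvent_mul [CompleteSpace X] (h : T.IsAnalyticExtension θ F)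
    (h0 : 0 ∈ T.generator.resolventSet) {z : ℂ} (hz : z ∈ T.generator.resolventSet)
    {e : ℂ} (he : e ∈ openSector θ) {r : ℝ} (hr : 0 < r) :
    HasDerivAt (fun r : ℝ => Complex.exp (-z * (r * e)) • (T.generator.resolvent z * F (r * e)))
      (-(e • Complex.exp (-z * (r * e)) • F (r * e))) r := by
  have hmem := smul_mem_openSector hr he
  have h1 : HasDerivAt (fun r : ℝ => (r : ℂ) * e) e r := by
    simpa using (Complex.ofRealCLM.hasDerivAt (x := r)).mul_const e
  have h2 : HasDerivAt (fun r : ℝ => F (r * e)) (e • deriv F (r * e)) r :=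
    HasDerivAt.scomp (g₁ := F) (h := fun r : ℝ => (r : ℂ) * e) r
      (h.analytic _ hmem).differentiableAt.hasDerivAt h1
  have h3 : HasDerivAt (fun r : ℝ => Complex.exp (-z * (r * e)))
      (Complex.exp (-z * (r * e)) * (-z * e)) r := (h1.const_mul (-z)).cexp
  have h4 := h3.smul (h2.const_mul (T.generator.resolvent z))
  refine h4.congr_deriv ?_
  have h5 := h.eq_neg_resolvent_mul_deriv h0 hmem
  have h6 := LinearPMap.resolvent_sub_resolvent h0 hz
  rw [sub_zero] at h6
  -- Bounded form of R(z, A) A = z R(z, A) - I on the range of F; A itself never appears because F'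
  -- is eliminated through R(0, A).
  have h7 : T.generator.resolvent z * deriv F (r * e) =
      z • (T.generator.resolvent z * F (r * e)) - F (r * e) := by
    have h8 : T.generator.resolvent z * T.generator.resolvent 0 =
        T.generator.resolvent 0 * T.generator.resolvent z :=
      LinearPMap.resolvent_commute hz h0
    have h9 : T.generator.resolvent z =
        T.generator.resolvent 0 - z • (T.generator.resolvent z * T.generator.resolvent 0) := by
      rw [h8, ← h6]; abel
    nth_rw 1 [h9]
    rw [h5, mul_neg, sub_mul, smul_mul_assoc, mul_assoc]
    simp only [smul_neg]
    abel
  rw [mul_smul_comm, h7]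
  module

end IsAnalyticExtension

end C0Semigroup

/-- The fundamental theorem of calculus on `(0, ∞)`, for a function with limits at both ends. -/
theorem integral_Ioi_zero_of_hasDerivAt_of_tendsto {E : Type*} [NormedAddCommGroup E]
    [NormedSpace ℝ E] [CompleteSpace E] {f f' : ℝ → E} {l m : E}
    (hderiv : ∀ x ∈ Ioi (0 : ℝ), HasDerivAt f (f' x) x) (hint : IntegrableOn f' (Ioi 0))
    (h0 : Tendsto f (𝓝[>] 0) (𝓝 l)) (hm : Tendsto f atTop (𝓝 m)) :
    ∫ x in Ioi (0 : ℝ), f' x = m - l := by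
  -- Only a one-sided limit at 0 is known, so the value at 0 is reset to it to obtain right
  -- continuity.
  have h1 := integral_Ioi_of_hasDerivAt_of_tendsto (f := Function.update f 0 l) (a := 0) (m := m)
    ?_ (fun x hx => ?_) hint ?_
  · simpa using h1
  · rw [continuousWithinAt_update_same]
    simpa [Ici_sdiff_left] using h0
  · refine (hderiv x hx).congr_of_eventuallyEq ?_
    filter_upwards [eventually_ne_nhds (ne_of_gt hx)] with y hy
    rw [Function.update_of_ne hy]
  · refine hm.congr' ?_
    filter_upwards [eventually_ne_atTop 0] with y hy
    rw [Function.update_of_ne hy]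

/-! ### Resolvent estimates and the Laplace transform -/

namespace C0Semigroup.IsAnalyticExtension

variable {X : Type*} [NormedAddCommGroup X] [NormedSpace ℂ X] {T : C0Semigroup X}
variable {θ : ℝ} {F : ℂ → X →L[ℂ] X}

theorem tendsto_ray (h : T.IsAnalyticExtension θ F) {e : ℂ} (he : e ∈ openSector θ) (x : X) :
    Tendsto (fun r : ℝ => F (r * e) x) (𝓝[>] 0) (𝓝 x) := by
  obtain ⟨θ', h1, h2⟩ := exists_between he.2
  refine (h.tendsto θ' ((abs_nonneg _).trans_lt h1) h2 x).comp ?_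
  refine tendsto_nhdsWithin_iff.2 ⟨?_, ?_⟩
  · have : Continuous fun r : ℝ => (r : ℂ) * e := by fun_prop
    simpa using (this.tendsto 0).mono_left nhdsWithin_le_nhds
  · filter_upwards [self_mem_nhdsWithin] with r hr
    exact smul_mem_openSector hr ⟨he.1, h1⟩

theorem tendsto_resolvent_ray (h : T.IsAnalyticExtension θ F) {e : ℂ} (he : e ∈ openSector θ)
    (z : ℂ) (x : X) :
    Tendsto (fun r : ℝ => (Complex.exp (-z * (r * e)) • (T.generator.resolvent z * F (r * e))) x)
      (𝓝[>] 0) (𝓝 (T.generator.resolvent z x)) := by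
  have h1 : Tendsto (fun r : ℝ => Complex.exp (-z * (r * e))) (𝓝[>] 0) (𝓝 1) := by
    have : Continuous fun r : ℝ => Complex.exp (-z * (r * e)) := by fun_prop
    simpa using (this.tendsto 0).mono_left nhdsWithin_le_nhds
  have h2 := h1.smul (((T.generator.resolvent z).continuous.tendsto _).comp (h.tendsto_ray he x))
  rw [one_smul] at h2
  exact h2

theorem hasDerivAt_resolvent_mul_apply [CompleteSpace X] (h : T.IsAnalyticExtension θ F)
    (h0 : 0 ∈ T.generator.resolventSet) {z : ℂ} (hz : z ∈ T.generator.resolventSet)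
    {e : ℂ} (he : e ∈ openSector θ) {r : ℝ} (hr : 0 < r) (x : X) :
    HasDerivAt
      (fun r : ℝ => (Complex.exp (-z * (r * e)) • (T.generator.resolvent z * F (r * e))) x)
      ((-(e • Complex.exp (-z * (r * e)) • F (r * e))) x) r :=
  ((ContinuousLinearMap.apply ℂ X x).restrictScalars ℝ).hasFDerivAt.comp_hasDerivAt r
    (h.hasDerivAt_resolvent_mul h0 hz he hr)

theorem continuousOn_ray (h : T.IsAnalyticExtension θ F) {e : ℂ} (he : e ∈ openSector θ) :
    ContinuousOn (fun r : ℝ => F (r * e)) (Ioi 0) := by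
  intro r hr
  have h1 : Continuous fun r : ℝ => (r : ℂ) * e := by fun_prop
  exact (ContinuousAt.comp (f := fun r : ℝ => (r : ℂ) * e)
    (h.analytic _ (smul_mem_openSector hr he)).continuousAt h1.continuousAt).continuousWithinAt

/-- A resolvent estimate from the boundedness of the semigroup on a segment of a ray. -/
theorem norm_resolvent_le_of_ray [CompleteSpace X] (h : T.IsAnalyticExtension θ F)
    (h0 : 0 ∈ T.generator.resolventSet) {z : ℂ} (hz : z ∈ T.generator.resolventSet)
    {e : ℂ} (he : e ∈ openSector θ) (he1 : ‖e‖ = 1) {M δ κ : ℝ} (hM : 0 ≤ M) (hδ : 0 < δ)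
    (hF : ∀ r : ℝ, 0 < r → r ≤ δ → ‖F (r * e)‖ ≤ M) (hκ : 0 < κ) (hκz : κ ≤ (z * e).re) :
    ‖T.generator.resolvent z‖ ≤ M / κ + Real.exp (-κ * δ) * M * ‖T.generator.resolvent z‖ := by
  refine ContinuousLinearMap.opNorm_le_bound _ (by positivity) fun x => ?_
  set R := T.generator.resolvent z with hR
  have hexp : ∀ r : ℝ, 0 < r → ‖Complex.exp (-z * (r * e))‖ ≤ Real.exp (-κ * r) := by
    intro r hr
    rw [Complex.norm_exp]
    have : (-z * (r * e)).re = -(z * e).re * r := by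
      rw [show -z * (r * e) = (-(z * e)) * (r : ℂ) by ring, Complex.re_mul_ofReal, Complex.neg_re]
    rw [this]
    gcongr
  have hbound : ∀ r : ℝ, 0 < r → r ≤ δ →
      ‖(-(e • Complex.exp (-z * (r * e)) • F (r * e))) x‖ ≤ Real.exp (-κ * r) * (M * ‖x‖) := by
    intro r hr hr'
    simp only [_root_.neg_apply, _root_.smul_apply, norm_neg, norm_smul, he1, one_mul]
    gcongr
    · exact hexp r hr
    · exact (F (r * e)).le_of_opNorm_le (hF r hr hr') x
  have hcont : ContinuousOn (fun r : ℝ => (-(e • Complex.exp (-z * (r * e)) • F (r * e))) x)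
      (Ioc 0 δ) := by
    have h1 : ContinuousOn (fun r : ℝ => -(e • Complex.exp (-z * (r * e)) • F (r * e)))
        (Ioc 0 δ) := by
      have h2 : Continuous fun r : ℝ => Complex.exp (-z * (r * e)) := by fun_prop
      exact ((h2.continuousOn.smul ((h.continuousOn_ray he).mono Ioc_subset_Ioi_self)).const_smul
        e).neg
    exact h1.clm_apply continuousOn_const
  have hint : IntervalIntegrable (fun r : ℝ => (-(e • Complex.exp (-z * (r * e)) • F (r * e))) x)
      volume 0 δ := by
    rw [intervalIntegrable_iff_integrableOn_Ioc_of_le hδ.le]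
    refine Integrable.mono' (g := fun _ => M * ‖x‖) (integrable_const _)
      (hcont.aestronglyMeasurable measurableSet_Ioc) ?_
    refine (ae_restrict_iff' measurableSet_Ioc).2 (Eventually.of_forall fun r hr => ?_)
    refine (hbound r hr.1 hr.2).trans (mul_le_of_le_one_left (by positivity) ?_)
    rw [Real.exp_le_one_iff]
    nlinarith [hr.1]
  -- The integration stops at δ because F is only controlled near 0 on the ray; the endpoint δ
  -- leaves a term with the factor e^{-κδ} ‖R(z, A)‖.
  have hftc := intervalIntegral.integral_eq_sub_of_hasDerivAt_of_tendsto hδ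
    (fun r hr => h.hasDerivAt_resolvent_mul_apply h0 hz he hr.1 x) hint
    (h.tendsto_resolvent_ray he z x)
    ((h.hasDerivAt_resolvent_mul_apply h0 hz he hδ x).continuousAt.mono_left nhdsWithin_le_nhds)
  have hI : ∫ r in 0..δ, Real.exp (-κ * r) * (M * ‖x‖) ≤ M / κ * ‖x‖ := by
    rw [intervalIntegral.integral_mul_const]
    have h1 : ∫ r in 0..δ, Real.exp (-κ * r) = (1 - Real.exp (-κ * δ)) / κ := by
      rw [intervalIntegral.integral_comp_mul_left (fun r => Real.exp r) (neg_ne_zero.2 hκ.ne'),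
        integral_exp]
      simp
      field_simp
      ring
    rw [h1]
    have h2 : (1 - Real.exp (-κ * δ)) / κ ≤ 1 / κ := by
      gcongr
      linarith [Real.exp_pos (-κ * δ)]
    calc _ ≤ 1 / κ * (M * ‖x‖) := by gcongr
      _ = _ := by ring
  have hI2 : ‖∫ r in 0..δ, (-(e • Complex.exp (-z * (r * e)) • F (r * e))) x‖ ≤ M / κ * ‖x‖ := by
    refine (intervalIntegral.norm_integral_le_of_norm_le hδ.le ?_ ?_).trans hI
    · exact Eventually.of_forall fun r hr => hbound r hr.1 hr.2
    · exact (by fun_prop : Continuous fun r : ℝ => Real.exp (-κ * r) * (M * ‖x‖)).intervalIntegrable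
        _ _
  rw [hftc] at hI2
  have h3 : ‖(Complex.exp (-z * (δ * e)) • (R * F (δ * e))) x‖ ≤
      Real.exp (-κ * δ) * M * ‖R‖ * ‖x‖ := by
    rw [_root_.smul_apply, mul_apply_eq_comp, norm_smul]
    calc _ ≤ Real.exp (-κ * δ) * (‖R‖ * (M * ‖x‖)) := by
          gcongr
          · exact hexp δ hδ
          · exact R.le_of_opNorm_le_of_le le_rfl ((F (δ * e)).le_of_opNorm_le (hF δ hδ le_rfl) x)
      _ = _ := by ring
  have h4 := norm_sub_norm_le (R x) ((Complex.exp (-z * (δ * e)) • (R * F (δ * e))) x)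
  rw [norm_sub_rev] at hI2
  rw [add_mul]
  linarith

/-- The resolvent is `O(1 / |z|)` on closed sectors of half-angle less than `π / 2 + θ` that are
contained in the resolvent set. -/
theorem exists_norm_resolvent_le [CompleteSpace X] (h : T.IsAnalyticExtension θ F) {ψ₁ : ℝ}
    (hψ₀ : 0 ≤ ψ₁) (hψ₁ : ψ₁ < Real.pi / 2 + θ)
    (hρ : ∀ r ψ : ℝ, 0 ≤ r → |ψ| ≤ ψ₁ →
      (r : ℂ) * Complex.exp (ψ * Complex.I) ∈ T.generator.resolventSet) :
    ∃ C : ℝ, 0 < C ∧ ∀ r ψ : ℝ, 0 ≤ r → |ψ| ≤ ψ₁ →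
      ‖T.generator.resolvent ((r : ℂ) * Complex.exp (ψ * Complex.I))‖ ≤ C / (1 + r) := by
  have h0 : (0 : ℂ) ∈ T.generator.resolventSet := by
    simpa using hρ 0 0 le_rfl (by simpa using hψ₀)
  -- With ψ₁ - π/2 < η < θ, rotation by ±η stays in the sector of analyticity and can bring every
  -- angle |ψ| ≤ ψ₁ strictly inside the right half-plane.
  obtain ⟨η, hη1, hη2⟩ := exists_between (max_lt h.pos (by linarith : ψ₁ - Real.pi / 2 < θ))
  obtain ⟨hη0, hη1⟩ := max_lt_iff.1 hη1
  obtain ⟨θ', hθ1, hθ2⟩ := exists_between hη2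
  obtain ⟨M, δ', hM, hδ', hF⟩ := h.exists_norm_le (hη0.trans hθ1) hθ2
  have hηpi : η < Real.pi / 2 := hη2.trans_le h.le
  set δ := δ' / 2 with hδ
  have hδ0 : 0 < δ := half_pos hδ'
  set m := max η (ψ₁ - η) with hm
  have hm1 : m < Real.pi / 2 := max_lt hηpi (by linarith)
  have hm0 : 0 ≤ m := hη0.le.trans (le_max_left _ _)
  set c := Real.cos m with hc
  have hc0 : 0 < c := Real.cos_pos_of_mem_Ioo ⟨by linarith [Real.pi_pos], hm1⟩
  have hmain : ∀ r ψ : ℝ, 0 < r → |ψ| ≤ ψ₁ →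
      ‖T.generator.resolvent ((r : ℂ) * Complex.exp (ψ * Complex.I))‖ ≤ M / (c * r) +
        Real.exp (-(c * r) * δ) * M *
          ‖T.generator.resolvent ((r : ℂ) * Complex.exp (ψ * Complex.I))‖ := by
    intro r ψ hr hψ
    -- The rotation goes against the sign of ψ, so that Re(z e) ≥ r cos m with m < π/2.
    obtain ⟨η', hη', hψη⟩ : ∃ η' : ℝ, |η'| = η ∧ |ψ + η'| ≤ m := by
      rw [abs_le] at hψ
      rcases le_total 0 ψ with h1 | h1
      · refine ⟨-η, by rw [abs_neg, abs_of_pos hη0], abs_le.2 ⟨?_, ?_⟩⟩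
        · linarith [le_max_left η (ψ₁ - η)]
        · linarith [le_max_right η (ψ₁ - η)]
      · refine ⟨η, abs_of_pos hη0, abs_le.2 ⟨?_, ?_⟩⟩
        · linarith [le_max_right η (ψ₁ - η)]
        · linarith [le_max_left η (ψ₁ - η)]
    have he : Complex.exp (η' * Complex.I) ∈ openSector θ' :=
      exp_mul_I_mem_openSector (hθ2.trans h.lt_pi).le (hη'.trans_lt hθ1)
    refine h.norm_resolvent_le_of_ray h0 (hρ r ψ hr.le hψ) (e := Complex.exp (η' * Complex.I))
      ⟨he.1, he.2.trans hθ2⟩ (Complex.norm_exp_ofReal_mul_I _) hM.le hδ0 ?_ (by positivity) ?_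
    · intro r hr hr'
      refine hF _ (smul_mem_openSector hr he) ?_
      rw [norm_mul, Complex.norm_exp_ofReal_mul_I, mul_one, Complex.norm_real,
        Real.norm_of_nonneg hr.le]
      linarith
    · rw [mul_assoc, ← Complex.exp_add, ← add_mul, ← Complex.ofReal_add, Complex.re_ofReal_mul,
        Complex.exp_ofReal_mul_I_re, mul_comm]
      gcongr
      rw [hc, ← Real.cos_abs (ψ + η')]
      exact Real.cos_le_cos_of_nonneg_of_le_pi (abs_nonneg _) (by linarith) hψη
  -- For large r the factor in front of ‖R‖ is at most 1/2 and the term is absorbed; the remaining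
  -- bounded range of r is handled by compactness.
  have hev : ∀ᶠ r : ℝ in atTop, Real.exp (-(c * r) * δ) * M ≤ 1 / 2 := by
    have h1 : Tendsto (fun r : ℝ => Real.exp (-(c * r) * δ) * M) atTop (𝓝 (0 * M)) := by
      refine Tendsto.mul_const _ (Real.tendsto_exp_atBot.comp ?_)
      have : (fun r : ℝ => -(c * r) * δ) = fun r => (-(c * δ)) * r := by ext; ring
      rw [this]
      exact tendsto_id.const_mul_atTop_of_neg (neg_neg_iff_pos.2 (by positivity))
    rw [zero_mul] at h1
    exact h1.eventually_le_const (by norm_num)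
  obtain ⟨ρ', hρ'⟩ := eventually_atTop.1 hev
  set ρ := max ρ' 1 with hρdef
  have hρ1 : 1 ≤ ρ := le_max_right _ _
  have hcompact : IsCompact (Icc (0 : ℝ) ρ ×ˢ Icc (-ψ₁) ψ₁) := isCompact_Icc.prod isCompact_Icc
  have hcont : ContinuousOn (fun p : ℝ × ℝ =>
      T.generator.resolvent ((p.1 : ℂ) * Complex.exp (p.2 * Complex.I)))
      (Icc (0 : ℝ) ρ ×ˢ Icc (-ψ₁) ψ₁) := by
    refine LinearPMap.continuousOn_resolvent.comp (Continuous.continuousOn (by fun_prop)) ?_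
    rintro ⟨r, ψ⟩ ⟨hr, hψ⟩
    exact hρ r ψ hr.1 (abs_le.2 hψ)
  obtain ⟨C, hC⟩ := hcompact.exists_bound_of_continuousOn hcont
  have hC0 : 0 ≤ C := (norm_nonneg _).trans
    (hC (0, 0) ⟨⟨le_rfl, by linarith⟩, ⟨by simpa using hψ₀, hψ₀⟩⟩)
  refine ⟨C * (1 + ρ) + 4 * M / c, by positivity, fun r ψ hr hψ => ?_⟩
  rw [le_div_iff₀ (by positivity)]
  rcases le_total r ρ with h1 | h1
  · have h2 := hC (r, ψ) ⟨⟨hr, h1⟩, abs_le.1 hψ⟩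
    calc _ ≤ C * (1 + ρ) := by gcongr
      _ ≤ _ := le_add_of_nonneg_right (by positivity)
  · have hr1 : 1 ≤ r := hρ1.trans h1
    have hr0 : 0 < r := by linarith
    have h2 := hmain r ψ hr0 hψ
    have h3 := hρ' r ((le_max_left _ _).trans h1)
    have h4 : ‖T.generator.resolvent ((r : ℂ) * Complex.exp (ψ * Complex.I))‖ ≤
        2 * (M / (c * r)) := by
      nlinarith [norm_nonneg (T.generator.resolvent ((r : ℂ) * Complex.exp (ψ * Complex.I)))]
    calc _ ≤ 2 * (M / (c * r)) * (r + r) := by gcongr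
      _ = 4 * M / c := by field_simp; ring
      _ ≤ _ := le_add_of_nonneg_left (by positivity)

/-- Resolvents are Laplace transforms of the semigroup. -/
theorem resolvent_eq_integral [CompleteSpace X] (h : T.IsAnalyticExtension θ F)
    (hT : T.IsExponentiallyStable) (h0 : 0 ∈ T.generator.resolventSet) {r : ℝ} (hr : 0 ≤ r)
    (hrρ : (r : ℂ) ∈ T.generator.resolventSet) :
    IntegrableOn (fun t : ℝ => Real.exp (-r * t) • T t) (Ioi 0) ∧
      T.generator.resolvent r = ∫ t in Ioi (0 : ℝ), Real.exp (-r * t) • T t := by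
  obtain ⟨M, ω, hM, hω, hTM⟩ := hT.exists_norm_le
  have hexp : ∀ t : ℝ, 0 < t → Real.exp (-r * t) ≤ 1 := fun t ht => by
    rw [Real.exp_le_one_iff]
    nlinarith
  have hint : IntegrableOn (fun t : ℝ => Real.exp (-r * t) • T t) (Ioi 0) := by
    refine Integrable.mono' ((exp_neg_integrableOn_Ioi 0 hω).const_mul M) ?_ ?_
    · refine ContinuousOn.aestronglyMeasurable ?_ measurableSet_Ioi
      exact (by fun_prop : Continuous fun t : ℝ => Real.exp (-r * t)).continuousOn.smul
        h.continuousOn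
    · refine (ae_restrict_iff' measurableSet_Ioi).2 (Eventually.of_forall fun t ht => ?_)
      rw [norm_smul, Real.norm_of_nonneg (Real.exp_pos _).le]
      exact (mul_le_of_le_one_left (norm_nonneg _) (hexp t ht)).trans (hTM t (le_of_lt ht))
  refine ⟨hint, ?_⟩
  ext x
  rw [ContinuousLinearMap.integral_apply hint]
  have h1 : (1 : ℂ) ∈ openSector θ := by
    simpa using ofReal_mem_openSector h.pos one_pos
  have hlim : Tendsto (fun t : ℝ =>
      (Complex.exp (-r * (t * 1)) • (T.generator.resolvent r * F (t * 1))) x) atTop (𝓝 0) := by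
    have h2 : Tendsto (fun t : ℝ => ‖T.generator.resolvent r‖ * (M * Real.exp (-ω * t) * ‖x‖))
        atTop (𝓝 0) := by
      have h3 : Tendsto (fun t : ℝ => Real.exp (-ω * t)) atTop (𝓝 0) :=
        Real.tendsto_exp_atBot.comp (tendsto_id.const_mul_atTop_of_neg (neg_neg_iff_pos.2 hω))
      simpa using ((h3.const_mul M).mul_const ‖x‖).const_mul ‖T.generator.resolvent r‖
    refine squeeze_zero_norm' ?_ h2
    filter_upwards [eventually_gt_atTop 0] with t ht
    rw [mul_one, h.eq t ht, _root_.smul_apply, norm_smul, Complex.norm_exp, mul_apply_eq_comp]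
    have h4 : (-(r : ℂ) * t).re = -r * t := by norm_cast
    rw [h4]
    refine (mul_le_of_le_one_left (norm_nonneg _) (hexp t ht)).trans ?_
    exact ContinuousLinearMap.le_of_opNorm_le_of_le _ le_rfl ((T t).le_of_opNorm_le (hTM t ht.le) x)
  have h5 := integral_Ioi_zero_of_hasDerivAt_of_tendsto
    (f' := fun t => -(Real.exp (-r * t) • T t x)) (fun t ht => ?_) ?_
    (h.tendsto_resolvent_ray h1 r x) hlim
  · rw [integral_neg, zero_sub, neg_inj] at h5
    exact h5.symm
  · refine (h.hasDerivAt_resolvent_mul_apply h0 hrρ h1 ht x).congr_deriv ?_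
    rw [mul_one, h.eq t ht, one_smul]
    have h4 : Complex.exp (-(r : ℂ) * t) = (Real.exp (-r * t) : ℝ) := by push_cast; rfl
    rw [h4]
    rfl
  · exact (hint.apply_continuousLinearMap x).neg

end C0Semigroup.IsAnalyticExtension

/-! ### Rotation of the Dunford contour -/

theorem integrableOn_rpow_neg_div_one_add {α : ℝ} (h0 : 0 < α) (h1 : α < 1) :
    IntegrableOn (fun r : ℝ => r ^ (-α) / (1 + r)) (Ioi 0) := by
  have hmeas : ∀ s : Set ℝ, AEStronglyMeasurable (fun r : ℝ => r ^ (-α) / (1 + r))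
      (volume.restrict s) := fun s => by
    refine Measurable.aestronglyMeasurable ?_
    fun_prop
  rw [← Ioc_union_Ioi_eq_Ioi zero_le_one]
  refine IntegrableOn.union ?_ ?_
  · have h2 : IntegrableOn (fun r : ℝ => r ^ (-α)) (Ioc 0 1) := by
      rw [← intervalIntegrable_iff_integrableOn_Ioc_of_le zero_le_one]
      exact intervalIntegral.intervalIntegrable_rpow' (by linarith)
    refine Integrable.mono' h2 (hmeas _) ?_
    refine (ae_restrict_iff' measurableSet_Ioc).2 (Eventually.of_forall fun r hr => ?_)
    have := hr.1
    rw [Real.norm_of_nonneg (by positivity)]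
    exact div_le_self (by positivity) (by linarith)
  · have h2 : IntegrableOn (fun r : ℝ => r ^ (-α - 1)) (Ioi 1) :=
      integrableOn_Ioi_rpow_of_lt (by linarith) one_pos
    refine Integrable.mono' h2 (hmeas _) ?_
    refine (ae_restrict_iff' measurableSet_Ioi).2 (Eventually.of_forall fun r hr => ?_)
    have hr0 : 0 < r := one_pos.trans hr
    rw [Real.norm_of_nonneg (by positivity), Real.rpow_sub_one hr0.ne']
    gcongr
    linarith

theorem ofReal_mul_exp_cpow {r ψ : ℝ} (hr : 0 < r) (h1 : -Real.pi < ψ) (h2 : ψ ≤ Real.pi) (a : ℝ) :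
    ((r : ℂ) * Complex.exp (ψ * Complex.I)) ^ (a : ℂ) =
      ((r ^ a : ℝ) : ℂ) * Complex.exp (a * ψ * Complex.I) := by
  have hr' : (r : ℂ) ≠ 0 := by exact_mod_cast hr.ne'
  rw [Complex.cpow_def_of_ne_zero (mul_ne_zero hr' (Complex.exp_ne_zero _)),
    Complex.log_ofReal_mul hr (Complex.exp_ne_zero _), Complex.log_exp (by simpa using h1)
    (by simpa using h2), add_mul, Complex.exp_add, Complex.ofReal_cpow hr.le,
    Complex.cpow_def_of_ne_zero hr', Complex.ofReal_log hr.le]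
  congr 2
  ring

namespace LinearPMap

variable {X : Type*} [NormedAddCommGroup X] [NormedSpace ℂ X]

/-- The integrand of the Dunford integral for a fractional power, on the ray of angle `ψ`. -/
noncomputable def rayIntegrand (A : X →ₗ.[ℂ] X) (α ψ r : ℝ) : X →L[ℂ] X :=
  (((r ^ (-α) : ℝ) : ℂ) * Complex.exp ((1 - α) * ψ * Complex.I)) •
    A.resolvent ((r : ℂ) * Complex.exp (ψ * Complex.I))

variable {A : X →ₗ.[ℂ] X} {ψ₁ C α : ℝ}

theorem continuousOn_rayIntegrand
    (hρ : ∀ r ψ : ℝ, 0 ≤ r → |ψ| ≤ ψ₁ → (r : ℂ) * Complex.exp (ψ * Complex.I) ∈ A.resolventSet) :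
    ContinuousOn (fun p : ℝ × ℝ => A.rayIntegrand α p.1 p.2) (Icc (-ψ₁) ψ₁ ×ˢ Ioi 0) := by
  unfold rayIntegrand
  have h1 : Continuous fun p : ℝ × ℝ => Complex.exp ((1 - α) * p.1 * Complex.I) := by fun_prop
  refine ContinuousOn.smul (ContinuousOn.mul ?_ h1.continuousOn) ?_
  · refine Complex.continuous_ofReal.comp_continuousOn ?_
    exact ContinuousOn.rpow_const continuousOn_snd fun p hp => Or.inl (ne_of_gt hp.2)
  · refine continuousOn_resolvent.comp (Continuous.continuousOn (by fun_prop)) ?_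
    rintro ⟨ψ, r⟩ ⟨hψ, hr⟩
    exact hρ r ψ (le_of_lt hr) (abs_le.2 hψ)

theorem aestronglyMeasurable_rayIntegrand
    (hρ : ∀ r ψ : ℝ, 0 ≤ r → |ψ| ≤ ψ₁ → (r : ℂ) * Complex.exp (ψ * Complex.I) ∈ A.resolventSet)
    {ψ : ℝ} (hψ : ψ ∈ Icc (-ψ₁) ψ₁) :
    AEStronglyMeasurable (A.rayIntegrand α ψ) (volume.restrict (Ioi 0)) := by
  refine ContinuousOn.aestronglyMeasurable ?_ measurableSet_Ioi
  exact (continuousOn_rayIntegrand hρ).comp (f := fun r : ℝ => (ψ, r))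
    (Continuous.continuousOn (by fun_prop)) fun r hr => ⟨hψ, hr⟩

theorem norm_rayIntegrand_le
    (hC : ∀ r ψ : ℝ, 0 ≤ r → |ψ| ≤ ψ₁ →
      ‖A.resolvent ((r : ℂ) * Complex.exp (ψ * Complex.I))‖ ≤ C / (1 + r))
    {ψ r : ℝ} (hψ : ψ ∈ Icc (-ψ₁) ψ₁) (hr : 0 < r) :
    ‖A.rayIntegrand α ψ r‖ ≤ C * (r ^ (-α) / (1 + r)) := by
  have h1 : ‖Complex.exp ((1 - α) * ψ * Complex.I)‖ = 1 := by
    rw [show ((1 : ℂ) - α) * ψ = ((1 - α) * ψ : ℝ) by push_cast; rfl]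
    exact Complex.norm_exp_ofReal_mul_I _
  rw [rayIntegrand, norm_smul, norm_mul, h1, mul_one, Complex.norm_real,
    Real.norm_of_nonneg (by positivity)]
  calc _ ≤ r ^ (-α) * (C / (1 + r)) := by
        gcongr
        exact hC r ψ hr.le (abs_le.2 hψ)
    _ = _ := by ring

theorem norm_exp_one_sub_mul_I (α ψ : ℝ) : ‖Complex.exp ((1 - α) * ψ * Complex.I)‖ = 1 := by
  rw [show ((1 : ℂ) - α) * ψ = ((1 - α) * ψ : ℝ) by push_cast; rfl]
  exact Complex.norm_exp_ofReal_mul_I _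

/-- The derivative of `rayIntegrand` in the angle. -/
noncomputable def rayDeriv (A : X →ₗ.[ℂ] X) (α ψ r : ℝ) : X →L[ℂ] X :=
  (((r ^ (-α) : ℝ) : ℂ) * Complex.exp ((1 - α) * ψ * Complex.I) * Complex.I) •
    ((1 - α : ℂ) • A.resolvent ((r : ℂ) * Complex.exp (ψ * Complex.I)) -
      ((r : ℂ) * Complex.exp (ψ * Complex.I)) •
        (A.resolvent ((r : ℂ) * Complex.exp (ψ * Complex.I)) *
          A.resolvent ((r : ℂ) * Complex.exp (ψ * Complex.I))))

theorem norm_rayDeriv_le (hα : α ∈ Ioo (0 : ℝ) 1) (hC0 : 0 < C)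
    (hC : ∀ r ψ : ℝ, 0 ≤ r → |ψ| ≤ ψ₁ →
      ‖A.resolvent ((r : ℂ) * Complex.exp (ψ * Complex.I))‖ ≤ C / (1 + r))
    {ψ r : ℝ} (hψ : ψ ∈ Ioo (-ψ₁) ψ₁) (hr : 0 < r) :
    ‖A.rayDeriv α ψ r‖ ≤ (C + C * C) * (r ^ (-α) / (1 + r)) := by
  have h1 := hC r ψ hr.le (abs_le.2 ⟨hψ.1.le, hψ.2.le⟩)
  have h2 : ‖(1 - α : ℂ)‖ ≤ 1 := by
    rw [show (1 : ℂ) - α = (1 - α : ℝ) by push_cast; rfl, Complex.norm_real, Real.norm_eq_abs,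
      abs_le]
    constructor <;> linarith [hα.1, hα.2]
  rw [rayDeriv]
  simp only [norm_smul, norm_mul, norm_exp_one_sub_mul_I, Complex.norm_I, mul_one,
    Complex.norm_real]
  rw [Real.norm_of_nonneg (by positivity)]
  calc _ ≤ r ^ (-α) * (1 * (C / (1 + r)) + r * (C / (1 + r) * (C / (1 + r)))) := by
        gcongr
        refine (norm_sub_le _ _).trans ?_
        rw [norm_smul, norm_smul, norm_mul, Complex.norm_exp_ofReal_mul_I, mul_one,
          Complex.norm_real, Real.norm_of_nonneg hr.le]
        gcongr
        exact (norm_mul_le _ _).trans (mul_le_mul h1 h1 (norm_nonneg _) (by positivity))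
    _ ≤ r ^ (-α) * (1 * (C / (1 + r)) + (1 + r) * (C / (1 + r) * (C / (1 + r)))) := by
        gcongr
        linarith
    _ = _ := by field_simp

theorem hasDerivAt_rayIntegrand
    (hρ : ∀ r ψ : ℝ, 0 ≤ r → |ψ| ≤ ψ₁ → (r : ℂ) * Complex.exp (ψ * Complex.I) ∈ A.resolventSet)
    {ψ r : ℝ} (hψ : ψ ∈ Ioo (-ψ₁) ψ₁) (hr : 0 < r) :
    HasDerivAt (fun ψ => A.rayIntegrand α ψ r) (A.rayDeriv α ψ r) ψ := by
  have h1 : HasDerivAt (fun ψ : ℝ => (ψ : ℂ)) 1 ψ := Complex.ofRealCLM.hasDerivAt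
  have h2 : HasDerivAt (fun ψ : ℝ => (r : ℂ) * Complex.exp (ψ * Complex.I))
      ((r : ℂ) * (Complex.exp (ψ * Complex.I) * (1 * Complex.I))) ψ :=
    ((h1.mul_const Complex.I).cexp).const_mul _
  have h3 := (HasDerivWithinAt.scomp (g₁ := A.resolvent) (s := Ioo (-ψ₁) ψ₁)
    (h := fun ψ : ℝ => (r : ℂ) * Complex.exp (ψ * Complex.I)) ψ
    (hasDerivWithinAt_resolvent (hρ r ψ hr.le (abs_le.2 ⟨hψ.1.le, hψ.2.le⟩)))
    h2.hasDerivWithinAt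
    (fun ψ' hψ' => hρ r ψ' hr.le (abs_le.2 ⟨hψ'.1.le, hψ'.2.le⟩))).hasDerivAt
    (Ioo_mem_nhds hψ.1 hψ.2)
  have h4 : HasDerivAt (fun ψ : ℝ => ((r ^ (-α) : ℝ) : ℂ) *
      Complex.exp ((1 - α) * ψ * Complex.I))
      (((r ^ (-α) : ℝ) : ℂ) * (Complex.exp ((1 - α) * ψ * Complex.I) *
        ((1 - α) * 1 * Complex.I))) ψ :=
    (((h1.const_mul (1 - α : ℂ)).mul_const Complex.I).cexp).const_mul _
  refine (h4.smul h3).congr_deriv ?_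
  simp only [rayDeriv, Function.comp_apply]
  module

/-- The derivative of `rayIntegrand` in the angle is also a derivative in the radius. -/
theorem hasDerivAt_rayPrimitive
    (hρ : ∀ r ψ : ℝ, 0 ≤ r → |ψ| ≤ ψ₁ → (r : ℂ) * Complex.exp (ψ * Complex.I) ∈ A.resolventSet)
    {ψ r : ℝ} (hψ : ψ ∈ Ioo (-ψ₁) ψ₁) (hr : 0 < r) :
    HasDerivAt (fun r : ℝ => (((r ^ (1 - α) : ℝ) : ℂ) *
      (Complex.exp ((1 - α) * ψ * Complex.I) * Complex.I)) •
        A.resolvent ((r : ℂ) * Complex.exp (ψ * Complex.I))) (A.rayDeriv α ψ r) r := by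
  have h1 : HasDerivAt (fun r : ℝ => (r : ℂ)) 1 r := Complex.ofRealCLM.hasDerivAt
  have h2 := h1.mul_const (Complex.exp (ψ * Complex.I))
  have h3 := (HasDerivWithinAt.scomp (g₁ := A.resolvent) (s := Ioi 0)
    (h := fun r : ℝ => (r : ℂ) * Complex.exp (ψ * Complex.I)) r
    (hasDerivWithinAt_resolvent (hρ r ψ hr.le (abs_le.2 ⟨hψ.1.le, hψ.2.le⟩)))
    h2.hasDerivWithinAt
    (fun r' hr' => hρ r' ψ (le_of_lt hr') (abs_le.2 ⟨hψ.1.le, hψ.2.le⟩))).hasDerivAt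
    (Ioi_mem_nhds hr)
  have h4 : HasDerivAt (fun r : ℝ => ((r ^ (1 - α) : ℝ) : ℂ) *
      (Complex.exp ((1 - α) * ψ * Complex.I) * Complex.I))
      ((((1 - α) * r ^ (-α) : ℝ) : ℂ) * (Complex.exp ((1 - α) * ψ * Complex.I) * Complex.I)) r := by
    refine HasDerivAt.mul_const (HasDerivAt.ofReal_comp ?_) _
    refine (Real.hasDerivAt_rpow_const (p := 1 - α) (Or.inl hr.ne')).congr_deriv ?_
    rw [show (1 : ℝ) - α - 1 = -α by ring]
  refine (h4.smul h3).congr_deriv ?_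
  have h5 : r ^ (1 - α) = r * r ^ (-α) := by
    rw [sub_eq_add_neg, Real.rpow_add hr, Real.rpow_one]
  simp only [rayDeriv, Function.comp_apply, h5]
  push_cast
  module

theorem integrableOn_rayDeriv (hα : α ∈ Ioo (0 : ℝ) 1)
    (hρ : ∀ r ψ : ℝ, 0 ≤ r → |ψ| ≤ ψ₁ → (r : ℂ) * Complex.exp (ψ * Complex.I) ∈ A.resolventSet)
    (hC0 : 0 < C)
    (hC : ∀ r ψ : ℝ, 0 ≤ r → |ψ| ≤ ψ₁ →
      ‖A.resolvent ((r : ℂ) * Complex.exp (ψ * Complex.I))‖ ≤ C / (1 + r))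
    {ψ : ℝ} (hψ : ψ ∈ Ioo (-ψ₁) ψ₁) : IntegrableOn (A.rayDeriv α ψ) (Ioi 0) := by
  refine Integrable.mono' ((integrableOn_rpow_neg_div_one_add hα.1 hα.2).const_mul (C + C * C)) ?_
    ((ae_restrict_iff' measurableSet_Ioi).2
      (Eventually.of_forall fun r hr => norm_rayDeriv_le hα hC0 hC hψ hr))
  refine ContinuousOn.aestronglyMeasurable ?_ measurableSet_Ioi
  have h1 : ContinuousOn (fun r : ℝ => A.resolvent ((r : ℂ) * Complex.exp (ψ * Complex.I)))
      (Ioi 0) :=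
    continuousOn_resolvent.comp (Continuous.continuousOn (by fun_prop)) fun r hr =>
      hρ r ψ (le_of_lt hr) (abs_le.2 ⟨hψ.1.le, hψ.2.le⟩)
  have h2 : ContinuousOn (fun r : ℝ => ((r ^ (-α) : ℝ) : ℂ)) (Ioi 0) :=
    Complex.continuous_ofReal.comp_continuousOn
      (continuousOn_id.rpow_const fun r hr => Or.inl (ne_of_gt hr))
  have h3 : Continuous fun r : ℝ => (r : ℂ) * Complex.exp (ψ * Complex.I) := by fun_prop
  have h4 := (h1.const_smul (1 - α : ℂ)).sub (h3.continuousOn.smul (h1.mul h1))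
  exact ((h2.mul (continuousOn_const (c := Complex.exp ((1 - α) * ψ * Complex.I)))).mul
    (continuousOn_const (c := Complex.I))).smul h4

variable [CompleteSpace X]

/-- By the Cauchy–Riemann equations in polar form, the angular derivative of z^{-α} R(z) e^{iψ} is
the radial derivative of i r times it. The boundary terms vanish: r^{1-α} R is O(r^{1-α}) at 0 and
O(r^{-α}) at infinity. -/
theorem integral_rayDeriv (hα : α ∈ Ioo (0 : ℝ) 1)
    (hρ : ∀ r ψ : ℝ, 0 ≤ r → |ψ| ≤ ψ₁ → (r : ℂ) * Complex.exp (ψ * Complex.I) ∈ A.resolventSet)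
    (hC0 : 0 < C)
    (hC : ∀ r ψ : ℝ, 0 ≤ r → |ψ| ≤ ψ₁ →
      ‖A.resolvent ((r : ℂ) * Complex.exp (ψ * Complex.I))‖ ≤ C / (1 + r))
    {ψ : ℝ} (hψ : ψ ∈ Ioo (-ψ₁) ψ₁) : ∫ r in Ioi (0 : ℝ), A.rayDeriv α ψ r = 0 := by
  have hnorm : ∀ r : ℝ, 0 < r → ‖(((r ^ (1 - α) : ℝ) : ℂ) *
      (Complex.exp ((1 - α) * ψ * Complex.I) * Complex.I)) •
        A.resolvent ((r : ℂ) * Complex.exp (ψ * Complex.I))‖ ≤ r ^ (1 - α) * (C / (1 + r)) := by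
    intro r hr
    rw [norm_smul, norm_mul, norm_mul, norm_exp_one_sub_mul_I, Complex.norm_I, mul_one, mul_one,
      Complex.norm_real, Real.norm_of_nonneg (by positivity)]
    gcongr
    exact hC r ψ hr.le (abs_le.2 ⟨hψ.1.le, hψ.2.le⟩)
  have h0 : Tendsto (fun r : ℝ => r ^ (1 - α) * C) (𝓝[>] 0) (𝓝 0) := by
    have h1 : Tendsto (fun r : ℝ => r ^ (1 - α)) (𝓝[>] 0) (𝓝 0) := by
      have := (Real.continuousAt_rpow_const 0 (1 - α) (Or.inr (by linarith [hα.2]))).tendsto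
      rw [Real.zero_rpow (by linarith [hα.2])] at this
      exact this.mono_left nhdsWithin_le_nhds
    simpa using h1.mul_const C
  have hinf : Tendsto (fun r : ℝ => r ^ (-α) * C) atTop (𝓝 0) := by
    simpa using (tendsto_rpow_neg_atTop hα.1).mul_const C
  rw [integral_Ioi_zero_of_hasDerivAt_of_tendsto (l := 0) (m := 0)
    (fun r hr => hasDerivAt_rayPrimitive hρ hψ hr) (integrableOn_rayDeriv hα hρ hC0 hC hψ),
    sub_zero]
  · refine squeeze_zero_norm' ?_ h0
    filter_upwards [self_mem_nhdsWithin] with r hr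
    have hr' : 0 < r := hr
    refine (hnorm r hr).trans ?_
    gcongr
    exact div_le_self hC0.le (by linarith)
  · refine squeeze_zero_norm' ?_ hinf
    filter_upwards [eventually_gt_atTop 0] with r hr
    refine (hnorm r hr).trans ?_
    rw [sub_eq_add_neg, Real.rpow_add hr, Real.rpow_one]
    calc r * r ^ (-α) * (C / (1 + r)) ≤ (1 + r) * r ^ (-α) * (C / (1 + r)) := by
          gcongr
          linarith
      _ = _ := by field_simp

/-- The Dunford integrals over rays do not depend on the angle of the ray. -/
theorem integral_rayIntegrand (hα : α ∈ Ioo (0 : ℝ) 1)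
    (hρ : ∀ r ψ : ℝ, 0 ≤ r → |ψ| ≤ ψ₁ → (r : ℂ) * Complex.exp (ψ * Complex.I) ∈ A.resolventSet)
    (hC0 : 0 < C)
    (hC : ∀ r ψ : ℝ, 0 ≤ r → |ψ| ≤ ψ₁ →
      ‖A.resolvent ((r : ℂ) * Complex.exp (ψ * Complex.I))‖ ≤ C / (1 + r))
    (hψ₁ : 0 < ψ₁) {ψ : ℝ} (hψ : ψ ∈ Icc (-ψ₁) ψ₁) :
    ∫ r in Ioi (0 : ℝ), A.rayIntegrand α ψ r = ∫ r in Ioi (0 : ℝ), A.rayIntegrand α 0 r := by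
  have hk := integrableOn_rpow_neg_div_one_add hα.1 hα.2
  have hcont : ContinuousOn (fun ψ => ∫ r in Ioi (0 : ℝ), A.rayIntegrand α ψ r)
      (Icc (-ψ₁) ψ₁) := by
    refine continuousOn_of_dominated (bound := fun r => C * (r ^ (-α) / (1 + r)))
      (fun ψ hψ => aestronglyMeasurable_rayIntegrand hρ hψ) (fun ψ hψ => ?_) (hk.const_mul C) ?_
    · refine (ae_restrict_iff' measurableSet_Ioi).2 (Eventually.of_forall fun r hr => ?_)
      exact norm_rayIntegrand_le hC hψ hr
    · refine (ae_restrict_iff' measurableSet_Ioi).2 (Eventually.of_forall fun r hr => ?_)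
      exact (continuousOn_rayIntegrand hρ).comp (f := fun ψ : ℝ => (ψ, r))
        (Continuous.continuousOn (by fun_prop)) fun ψ hψ => ⟨hψ, hr⟩
  have hderiv : ∀ ψ ∈ Ioo (-ψ₁) ψ₁,
      HasDerivAt (fun ψ => ∫ r in Ioi (0 : ℝ), A.rayIntegrand α ψ r) 0 ψ := by
    intro ψ hψ
    have h1 := (hasDerivAt_integral_of_dominated_loc_of_deriv_le
      (μ := volume.restrict (Ioi (0 : ℝ))) (F := fun ψ r => A.rayIntegrand α ψ r)
      (F' := A.rayDeriv α) (bound := fun r => (C + C * C) * (r ^ (-α) / (1 + r)))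
      (Ioo_mem_nhds hψ.1 hψ.2) ?_ ?_ (integrableOn_rayDeriv hα hρ hC0 hC hψ).aestronglyMeasurable
      ?_ (hk.const_mul _) ?_).2
    · rwa [integral_rayDeriv hα hρ hC0 hC hψ] at h1
    · filter_upwards [Ioo_mem_nhds hψ.1 hψ.2] with ψ hψ
      exact aestronglyMeasurable_rayIntegrand hρ ⟨hψ.1.le, hψ.2.le⟩
    · refine Integrable.mono' (hk.const_mul C)
        (aestronglyMeasurable_rayIntegrand hρ ⟨hψ.1.le, hψ.2.le⟩) ?_
      exact (ae_restrict_iff' measurableSet_Ioi).2 (Eventually.of_forall fun r hr =>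
        norm_rayIntegrand_le hC ⟨hψ.1.le, hψ.2.le⟩ hr)
    · exact (ae_restrict_iff' measurableSet_Ioi).2 (Eventually.of_forall fun r hr ψ hψ =>
        norm_rayDeriv_le hα hC0 hC hψ hr)
    · exact (ae_restrict_iff' measurableSet_Ioi).2 (Eventually.of_forall fun r hr ψ hψ =>
        hasDerivAt_rayIntegrand hρ hψ hr)
  -- Differentiation in the angle is available only for |ψ| < ψ₁; the edges ψ = ±ψ₁, where the
  -- contour itself lies, are reached by continuity.
  have hconst : EqOn (fun ψ => ∫ r in Ioi (0 : ℝ), A.rayIntegrand α ψ r)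
      (fun _ => ∫ r in Ioi (0 : ℝ), A.rayIntegrand α 0 r) (Ioo (-ψ₁) ψ₁) := fun ψ hψ =>
    isOpen_Ioo.is_const_of_deriv_eq_zero isPreconnected_Ioo
      (fun ψ hψ => (hderiv ψ hψ).differentiableAt.differentiableWithinAt)
      (fun ψ hψ => (hderiv ψ hψ).deriv) hψ ⟨neg_lt_zero.2 hψ₁, hψ₁⟩
  refine hconst.of_subset_closure hcont continuousOn_const Ioo_subset_Icc_self ?_ hψ
  rw [closure_Ioo (by linarith)]

end LinearPMap

/-! ### Balakrishnan's formula -/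

namespace LinearPMap

variable {X : Type*} [NormedAddCommGroup X] [NormedSpace ℂ X] {A : X →ₗ.[ℂ] X} {φ α : ℝ}

/-- The point -r e^{iψ} is 0 or has argument of modulus at least φ, hence lies outside S_φ ⊇ σ(-A).
-/
theorem mem_resolventSet_of_spectrumSet_neg_subset (hφ : φ ≤ Real.pi)
    (hσ : (-A).spectrumSet ⊆ openSector φ) {r ψ : ℝ} (hr : 0 ≤ r) (hψ : |ψ| ≤ Real.pi - φ)
    (hφ0 : 0 < φ) : (r : ℂ) * Complex.exp (ψ * Complex.I) ∈ A.resolventSet := by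
  have h1 : -((r : ℂ) * Complex.exp (ψ * Complex.I)) ∉ openSector φ := by
    rintro ⟨h0, h1⟩
    have hr' : 0 < r := hr.lt_of_ne fun h => h0 (by rw [← h]; simp)
    rw [abs_le] at hψ
    obtain ⟨ψ', h2, h3, h4⟩ : ∃ ψ' : ℝ, -Complex.exp (ψ * Complex.I) = Complex.exp (ψ' * Complex.I) ∧
        ψ' ∈ Ioc (-Real.pi) Real.pi ∧ φ ≤ |ψ'| := by
      rcases lt_or_ge 0 ψ with h | h
      · refine ⟨ψ - Real.pi, ?_, ⟨by linarith, by linarith⟩, ?_⟩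
        · push_cast
          rw [sub_mul, Complex.exp_sub_pi_mul_I]
        · rw [abs_of_nonpos (by linarith)]
          linarith
      · refine ⟨ψ + Real.pi, ?_, ⟨by linarith, by linarith⟩, ?_⟩
        · push_cast
          rw [add_mul, Complex.exp_add_pi_mul_I]
        · rw [abs_of_nonneg (by linarith)]
          linarith
    rw [← mul_neg, Complex.arg_real_mul _ hr', h2, Complex.arg_exp_mul_I,
      (toIocMod_eq_self Real.two_pi_pos).2 ⟨h3.1, by linarith [h3.2]⟩] at h1
    linarith
  have h2 : -((r : ℂ) * Complex.exp (ψ * Complex.I)) ∈ (-A).resolventSet := by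
    by_contra h
    exact h1 (hσ h)
  simpa using mem_resolventSet_of_neg h2

/-- The substitution z = -w turns the rays of angle ∓φ for -A into the rays of angle ±(π - φ) for A,
and z^{-α} contributes the phases e^{±iπα}. After rotation to angle 0 the two phases combine to
sin(πα). -/
theorem negFracPow_eq_rayIntegrand (hφ0 : 0 < φ) (hφ : φ < Real.pi)
    (hσ : (-A).spectrumSet ⊆ openSector φ) :
    negFracPow A φ α = (2 * (Real.pi : ℂ) * Complex.I)⁻¹ •
      (Complex.exp (Real.pi * α * Complex.I) •
          (∫ r in Ioi (0 : ℝ), A.rayIntegrand α (Real.pi - φ) r) -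
        Complex.exp (-(Real.pi * α * Complex.I)) •
          ∫ r in Ioi (0 : ℝ), A.rayIntegrand α (-(Real.pi - φ)) r) := by
  rw [negFracPow, ← integral_smul, ← integral_smul]
  have hpi : (0 : ℝ) ≤ Real.pi - φ := by linarith
  congr 2
  · refine setIntegral_congr_fun measurableSet_Ioi fun r hr => ?_
    have h1 : (r : ℂ) * Complex.exp (-(φ : ℂ) * Complex.I) =
        -((r : ℂ) * Complex.exp ((Real.pi - φ : ℝ) * Complex.I)) := by
      have : ((Real.pi - φ : ℝ) : ℂ) * Complex.I = -(φ : ℂ) * Complex.I + Real.pi * Complex.I := by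
        push_cast; ring
      rw [this, Complex.exp_add_pi_mul_I]
      ring
    have h2 := mem_resolventSet_of_spectrumSet_neg_subset hφ.le hσ (le_of_lt hr)
      (abs_of_nonneg hpi).le hφ0
    have h3 : ((r : ℂ) * Complex.exp (-(φ : ℂ) * Complex.I)) ^ (-(α : ℂ)) =
        ((r ^ (-α) : ℝ) : ℂ) * Complex.exp (α * φ * Complex.I) := by
      have := ofReal_mul_exp_cpow (ψ := -φ) hr (by linarith) (by linarith) (-α)
      push_cast at this ⊢
      rw [this]
      congr 2
      ring
    rw [h3, h1, resolvent_neg (by rwa [neg_neg]), neg_neg, rayIntegrand, smul_smul, smul_neg,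
      ← neg_smul]
    congr 1
    have h4 : Complex.exp (Real.pi * α * Complex.I) *
        Complex.exp ((1 - α) * (Real.pi - φ : ℝ) * Complex.I) =
        -(Complex.exp (α * φ * Complex.I) * Complex.exp (-(φ : ℂ) * Complex.I)) := by
      rw [← Complex.exp_add, ← Complex.exp_add, ← Complex.exp_add_pi_mul_I]
      congr 1
      push_cast
      ring
    rw [mul_left_comm, h4]
    ring
  · refine setIntegral_congr_fun measurableSet_Ioi fun r hr => ?_
    have h1 : (r : ℂ) * Complex.exp ((φ : ℂ) * Complex.I) =
        -((r : ℂ) * Complex.exp ((-(Real.pi - φ) : ℝ) * Complex.I)) := by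
      have : ((-(Real.pi - φ) : ℝ) : ℂ) * Complex.I = (φ : ℂ) * Complex.I - Real.pi * Complex.I := by
        push_cast; ring
      rw [this, Complex.exp_sub_pi_mul_I]
      ring
    have h2 := mem_resolventSet_of_spectrumSet_neg_subset hφ.le hσ (le_of_lt hr)
      ((abs_neg _).trans (abs_of_nonneg hpi)).le hφ0
    have h3 : ((r : ℂ) * Complex.exp ((φ : ℂ) * Complex.I)) ^ (-(α : ℂ)) =
        ((r ^ (-α) : ℝ) : ℂ) * Complex.exp (-(α * φ * Complex.I)) := by
      have := ofReal_mul_exp_cpow (ψ := φ) hr (by linarith) (by linarith) (-α)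
      push_cast at this ⊢
      rw [this]
      congr 2
      ring
    rw [h3, h1, resolvent_neg (by rwa [neg_neg]), neg_neg, rayIntegrand, smul_smul, smul_neg,
      ← neg_smul]
    congr 1
    have h4 : Complex.exp (-(Real.pi * α * Complex.I)) *
        Complex.exp ((1 - α) * (-(Real.pi - φ) : ℝ) * Complex.I) =
        -(Complex.exp (-(α * φ * Complex.I)) * Complex.exp ((φ : ℂ) * Complex.I)) := by
      rw [← Complex.exp_add, ← Complex.exp_add, ← Complex.exp_sub_pi_mul_I]
      congr 1
      push_cast
      ring
    rw [mul_left_comm, h4]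
    ring

/-- Balakrishnan's formula for the fractional powers. -/
theorem negFracPow_eq [CompleteSpace X] (hα : α ∈ Ioo (0 : ℝ) 1) (hφ0 : 0 < φ) (hφ : φ < Real.pi)
    (hσ : (-A).spectrumSet ⊆ openSector φ) {C : ℝ} (hC0 : 0 < C)
    (hC : ∀ r ψ : ℝ, 0 ≤ r → |ψ| ≤ Real.pi - φ →
      ‖A.resolvent ((r : ℂ) * Complex.exp (ψ * Complex.I))‖ ≤ C / (1 + r)) :
    negFracPow A φ α = ((Real.sin (Real.pi * α) / Real.pi : ℝ) : ℂ) •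
      ∫ r in Ioi (0 : ℝ), r ^ (-α) • A.resolvent r := by
  have hρ : ∀ r ψ : ℝ, 0 ≤ r → |ψ| ≤ Real.pi - φ →
      (r : ℂ) * Complex.exp (ψ * Complex.I) ∈ A.resolventSet := fun r ψ hr hψ =>
    mem_resolventSet_of_spectrumSet_neg_subset hφ.le hσ hr hψ hφ0
  have hψ₁ : 0 < Real.pi - φ := by linarith
  rw [negFracPow_eq_rayIntegrand hφ0 hφ hσ,
    integral_rayIntegrand hα hρ hC0 hC hψ₁ (right_mem_Icc.2 (by linarith)),
    integral_rayIntegrand hα hρ hC0 hC hψ₁ (left_mem_Icc.2 (by linarith)), ← sub_smul, smul_smul]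
  congr 1
  · have hpi : (Real.pi : ℂ) ≠ 0 := by exact_mod_cast Real.pi_ne_zero
    rw [Complex.ofReal_div, Complex.ofReal_sin, Complex.sin]
    field_simp
    push_cast
    rw [Complex.I_sq]
    ring_nf
  · refine setIntegral_congr_fun measurableSet_Ioi fun r _ => ?_
    simp [rayIntegrand]

end LinearPMap

/-! ### Fractional powers as Mellin transforms of the semigroup -/

namespace C0Semigroup.IsAnalyticExtension

variable {X : Type*} [NormedAddCommGroup X] [NormedSpace ℂ X] {T : C0Semigroup X}
variable {θ : ℝ} {F : ℂ → X →L[ℂ] X}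

theorem integrableOn_rpow_smul (h : T.IsAnalyticExtension θ F) (hT : T.IsExponentiallyStable)
    {a : ℝ} (ha : -1 < a) : IntegrableOn (fun t : ℝ => t ^ a • T t) (Ioi 0) := by
  obtain ⟨M, ω, hM, hω, hTM⟩ := hT.exists_norm_le
  have h1 := (integrableOn_rpow_mul_exp_neg_mul_rpow ha one_pos hω).const_mul M
  refine Integrable.mono' h1 ?_ ?_
  · refine ContinuousOn.aestronglyMeasurable ?_ measurableSet_Ioi
    exact (continuousOn_id.rpow_const fun r hr => Or.inl (ne_of_gt hr)).smul h.continuousOn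
  · refine (ae_restrict_iff' measurableSet_Ioi).2 (Eventually.of_forall fun t ht => ?_)
    have ht' : 0 < t := ht
    rw [norm_smul, Real.norm_of_nonneg (by positivity), Real.rpow_one]
    calc t ^ a * ‖T t‖ ≤ t ^ a * (M * Real.exp (-ω * t)) := by
          gcongr
          exact hTM t ht'.le
      _ = _ := by ring

variable [CompleteSpace X]

/-- Insert the Laplace transform for R(r, A), exchange the integrals by Fubini, and use ∫ r^{-α}
e^{-rt} dr = Γ(1-α) t^{α-1}. -/
theorem integral_rpow_smul_resolvent (h : T.IsAnalyticExtension θ F)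
    (hT : T.IsExponentiallyStable) {α : ℝ} (hα : α ∈ Ioo (0 : ℝ) 1)
    (hρ : ∀ r : ℝ, 0 ≤ r → (r : ℂ) ∈ T.generator.resolventSet) :
    ∫ r in Ioi (0 : ℝ), r ^ (-α) • T.generator.resolvent r =
      Real.Gamma (1 - α) • ∫ t in Ioi (0 : ℝ), t ^ (α - 1) • T t := by
  have h0 : (0 : ℂ) ∈ T.generator.resolventSet := by exact_mod_cast hρ 0 le_rfl
  have hα1 : 0 < 1 - α := by linarith [hα.2]
  have hgamma : ∀ t : ℝ, 0 < t → ∫ r in Ioi (0 : ℝ), r ^ (-α) * Real.exp (-r * t) =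
      t ^ (α - 1) * Real.Gamma (1 - α) := by
    intro t ht
    have h1 := Real.integral_rpow_mul_exp_neg_mul_Ioi hα1 ht
    rw [one_div, Real.inv_rpow ht.le, ← Real.rpow_neg ht.le, neg_sub] at h1
    rw [← h1]
    refine setIntegral_congr_fun measurableSet_Ioi fun r _ => ?_
    congr 2 <;> ring
  have hgint : ∀ t : ℝ, 0 < t → IntegrableOn (fun r : ℝ => r ^ (-α) * Real.exp (-r * t)) (Ioi 0) :=
    -- A Bochner integral of a non-integrable function is 0 by convention, so the nonzero Gamma
    -- value proves integrability.
    fun t ht => .of_integral_ne_zero (by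
      rw [hgamma t ht]
      have := Real.Gamma_pos_of_pos hα1
      positivity)
  set G : ℝ → ℝ → X →L[ℂ] X := fun r t => (r ^ (-α) * Real.exp (-r * t)) • T t with hG
  have hmeas : AEStronglyMeasurable (Function.uncurry G)
      ((volume.restrict (Ioi (0 : ℝ))).prod (volume.restrict (Ioi (0 : ℝ)))) := by
    rw [Measure.prod_restrict]
    refine ContinuousOn.aestronglyMeasurable ?_ (measurableSet_Ioi.prod measurableSet_Ioi)
    have h2 : ContinuousOn (fun p : ℝ × ℝ => p.1 ^ (-α)) (Ioi 0 ×ˢ Ioi 0) :=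
      continuousOn_fst.rpow_const fun p hp => Or.inl (ne_of_gt hp.1)
    have h3 : Continuous fun p : ℝ × ℝ => Real.exp (-p.1 * p.2) := by fun_prop
    exact (h2.mul h3.continuousOn).smul (h.continuousOn.comp continuousOn_snd fun p hp => hp.2)
  have hint : Integrable (Function.uncurry G)
      ((volume.restrict (Ioi (0 : ℝ))).prod (volume.restrict (Ioi (0 : ℝ)))) := by
    refine (integrable_prod_iff' hmeas).2 ⟨?_, ?_⟩
    · refine (ae_restrict_iff' measurableSet_Ioi).2 (Eventually.of_forall fun t ht => ?_)
      exact (hgint t ht).smul_const (T t)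
    · have h4 := (h.integrableOn_rpow_smul hT (a := α - 1) (by linarith [hα.1])).norm.const_mul
        (Real.Gamma (1 - α))
      refine h4.congr ((ae_restrict_iff' measurableSet_Ioi).2 (Eventually.of_forall fun t ht => ?_))
      have ht' : 0 < t := ht
      have h5 : ∫ r in Ioi (0 : ℝ), ‖Function.uncurry G (r, t)‖ =
          ∫ r in Ioi (0 : ℝ), r ^ (-α) * Real.exp (-r * t) * ‖T t‖ := by
        refine setIntegral_congr_fun measurableSet_Ioi fun r hr => ?_
        have hr' : 0 < r := hr
        simp only [Function.uncurry_apply_pair, hG, norm_smul]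
        rw [Real.norm_of_nonneg (by positivity)]
      simp only
      rw [h5, integral_mul_const, hgamma t ht, norm_smul, Real.norm_of_nonneg (by positivity)]
      ring
  calc ∫ r in Ioi (0 : ℝ), r ^ (-α) • T.generator.resolvent r
      = ∫ r in Ioi (0 : ℝ), ∫ t in Ioi (0 : ℝ), G r t := by
        refine setIntegral_congr_fun measurableSet_Ioi fun r hr => ?_
        simp only [hG]
        rw [(h.resolvent_eq_integral hT h0 (le_of_lt hr) (hρ r (le_of_lt hr))).2, ← integral_smul]
        simp_rw [smul_smul]
    _ = ∫ t in Ioi (0 : ℝ), ∫ r in Ioi (0 : ℝ), G r t := integral_integral_swap hint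
    _ = ∫ t in Ioi (0 : ℝ), Real.Gamma (1 - α) • (t ^ (α - 1) • T t) := by
        refine setIntegral_congr_fun measurableSet_Ioi fun t ht => ?_
        simp only [hG]
        rw [integral_smul_const, hgamma t ht, smul_smul, mul_comm]
    _ = _ := integral_smul _ _

/-- The fractional powers as Mellin transforms of the semigroup. -/
theorem negFracPow_eq_integral (h : T.IsAnalyticExtension θ F) (hT : T.IsExponentiallyStable)
    {φ : ℝ} (hφ : φ ∈ Ioc (Real.pi / 2 - θ) (Real.pi / 2))
    (hσ : (-T.generator).spectrumSet ⊆ openSector φ) {α : ℝ} (hα : α ∈ Ioo (0 : ℝ) 1) :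
    ∃ c : ℂ, c ≠ 0 ∧
      negFracPow T.generator φ α = c • ∫ t in Ioi (0 : ℝ), t ^ (α - 1) • T t := by
  have hφ0 : 0 < φ := by linarith [hφ.1, h.le]
  have hφpi : φ < Real.pi := by linarith [hφ.2, Real.pi_pos]
  have hρ : ∀ r ψ : ℝ, 0 ≤ r → |ψ| ≤ Real.pi - φ →
      (r : ℂ) * Complex.exp (ψ * Complex.I) ∈ T.generator.resolventSet := fun r ψ hr hψ =>
    LinearPMap.mem_resolventSet_of_spectrumSet_neg_subset hφpi.le hσ hr hψ hφ0
  -- The condition φ > π/2 - θ says precisely that π - φ < π/2 + θ.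
  obtain ⟨C, hC0, hC⟩ := h.exists_norm_resolvent_le (ψ₁ := Real.pi - φ) (by linarith)
    (by linarith [hφ.1]) hρ
  -- By the reflection formula this constant is 1/Γ(α), but only its nonvanishing matters.
  refine ⟨((Real.sin (Real.pi * α) / Real.pi * Real.Gamma (1 - α) : ℝ) : ℂ), ?_, ?_⟩
  · have h1 : 0 < Real.sin (Real.pi * α) := by
      refine Real.sin_pos_of_pos_of_lt_pi (mul_pos Real.pi_pos hα.1) ?_
      exact mul_lt_of_lt_one_right Real.pi_pos hα.2
    have h2 := Real.Gamma_pos_of_pos (by linarith [hα.2] : 0 < 1 - α)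
    have h3 := Real.pi_pos
    exact_mod_cast (by positivity : Real.sin (Real.pi * α) / Real.pi * Real.Gamma (1 - α) ≠ 0)
  · rw [LinearPMap.negFracPow_eq hα hφ0 hφpi hσ hC0 hC,
      h.integral_rpow_smul_resolvent hT hα fun r hr => by
        simpa using hρ r 0 hr (by rw [abs_zero]; linarith), Complex.ofReal_mul, mul_smul]
    rfl

/-- The product of two complementary Mellin transforms of the semigroup is a multiple of the
resolvent at `0`. -/
theorem integral_mul_integral (h : T.IsAnalyticExtension θ F) (hT : T.IsExponentiallyStable)
    (h0 : 0 ∈ T.generator.resolventSet) {α : ℝ} (hα : α ∈ Ioo (0 : ℝ) 1) :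
    ∃ c : ℂ, c ≠ 0 ∧
      (∫ t in Ioi (0 : ℝ), t ^ (-α) • T t) * (∫ t in Ioi (0 : ℝ), t ^ (α - 1) • T t) =
        c • T.generator.resolvent 0 := by
  refine ⟨Complex.betaIntegral (1 - α : ℝ) α, ?_, ?_⟩
  · have h1 := Complex.Gamma_mul_Gamma_eq_betaIntegral (s := (1 - α : ℝ)) (t := α)
      (by simpa using hα.2) (by simpa using hα.1)
    intro h2
    rw [h2, mul_zero, Complex.Gamma_ofReal, Complex.Gamma_ofReal, ← Complex.ofReal_mul] at h1
    have h3 := Real.Gamma_pos_of_pos (by linarith [hα.2] : 0 < 1 - α)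
    have h4 := Real.Gamma_pos_of_pos hα.1
    have h5 : Real.Gamma (1 - α) * Real.Gamma α = 0 := by exact_mod_cast h1
    exact (mul_pos h3 h4).ne' h5
  · have h1 := integral_posConvolution (μ := volume) (ν := volume)
      (h.integrableOn_rpow_smul hT (a := -α) (by linarith [hα.2]))
      (h.integrableOn_rpow_smul hT (a := α - 1) (by linarith [hα.1]))
      (ContinuousLinearMap.mul ℝ (X →L[ℂ] X))
    simp only [ContinuousLinearMap.mul_apply'] at h1
    have h2 := (h.resolvent_eq_integral hT h0 le_rfl (by simpa using h0)).2
    rw [← h1, ← Complex.ofReal_zero, h2, ← integral_smul]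
    refine setIntegral_congr_fun measurableSet_Ioi fun x hx => ?_
    have hx' : 0 < x := hx
    have hbeta := Complex.betaIntegral_scaled (1 - α : ℝ) α hx'
    have hx1 : (x : ℂ) ^ (((1 - α : ℝ) : ℂ) + α - 1) = 1 := by
      rw [show ((1 - α : ℝ) : ℂ) + α - 1 = 0 by push_cast; ring, Complex.cpow_zero]
    rw [hx1, one_mul] at hbeta
    rw [← hbeta, neg_zero, zero_mul, Real.exp_zero, one_smul, ← intervalIntegral.integral_smul_const,
      intervalIntegral.integral_of_le hx'.le, intervalIntegral.integral_of_le hx'.le]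
    refine setIntegral_congr_fun measurableSet_Ioc fun t ht => ?_
    have ht1 : 0 < t := ht.1
    have ht2 : 0 ≤ x - t := by linarith [ht.2]
    rw [smul_mul_smul_comm, T.mul_eq ht1.le ht2, add_sub_cancel]
    have h3 : (t : ℂ) ^ (((1 - α : ℝ) : ℂ) - 1) = ((t ^ (-α) : ℝ) : ℂ) := by
      rw [Complex.ofReal_cpow ht1.le]
      congr 1
      push_cast
      ring
    have h4 : ((x : ℂ) - t) ^ ((α : ℂ) - 1) = (((x - t) ^ (α - 1) : ℝ) : ℂ) := by
      rw [Complex.ofReal_cpow ht2]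
      push_cast
      rfl
    rw [h3, h4, ← Complex.ofReal_mul]
    rfl

end C0Semigroup.IsAnalyticExtension

/-! ### Extrapolation spaces realized inside X -/

section Lifting

variable {U E X : Type*} [NormedAddCommGroup U] [NormedSpace ℂ U] [NormedAddCommGroup E]
  [NormedSpace ℂ E] [NormedAddCommGroup X] [NormedSpace ℂ X]

/-- Bounded operators lift through injective bounded operators, if they do so pointwise with
uniform bounds. -/
theorem ContinuousLinearMap.exists_lift {R : E →L[ℂ] X} (hR : Function.Injective R) (S : U →L[ℂ] X)
    {C : ℝ} (h : ∀ u, ∃ y, R y = S u ∧ ‖y‖ ≤ C * ‖u‖) : ∃ L : U →L[ℂ] E, ∀ u, R (L u) = S u := by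
  choose f hf hfC using h
  refine ⟨LinearMap.mkContinuous
    { toFun := f
      map_add' := fun u v => hR (by rw [hf, map_add, map_add, hf, hf])
      map_smul' := fun c u => hR (by rw [hf, map_smul, map_smul, hf]; rfl) } C hfC, hf⟩

end Lifting

namespace Extrapolated

variable {X Y : Type*} [NormedAddCommGroup X] [NormedSpace ℂ X] [NormedAddCommGroup Y]
  [NormedSpace ℂ Y] (J : X →L[ℂ] X)

theorem denseRange_of : DenseRange (of J) :=
  UniformSpace.Completion.denseRange_coe.comp (Renormed.of J).surjective.denseRange
    (UniformSpace.Completion.continuous_coe _)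

variable {J} in
theorem ext_of {f g : Extrapolated J →L[ℂ] Y} (h : ∀ x, f (of J x) = g (of J x))
    (y : Extrapolated J) : f y = g y :=
  congr_fun ((denseRange_of J).equalizer f.continuous g.continuous (funext h)) y

theorem exists_extension [CompleteSpace Y] (f : X →ₗ[ℂ] Y) {C : ℝ}
    (hf : ∀ x, ‖f x‖ ≤ C * ‖J x‖) :
    ∃ g : Extrapolated J →L[ℂ] Y, ∀ x, g (of J x) = f x := by
  let f' : Renormed J →L[ℂ] Y :=
    LinearMap.mkContinuous (f ∘ₗ ((Renormed.of J).symm : Renormed J →ₗ[ℂ] X)) C fun x => hf _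
  refine ⟨f'.extend UniformSpace.Completion.toComplL, fun x => ?_⟩
  exact f'.extend_eq UniformSpace.Completion.denseRange_coe
    (UniformSpace.Completion.isUniformInducing_coe _) (Renormed.of J x)

variable [CompleteSpace X]

/-- The isometric extension of `J` to the completion of `X` in the norm `x ↦ ‖J x‖`. -/
noncomputable def realize : Extrapolated J →L[ℂ] X :=
  (exists_extension J (J : X →ₗ[ℂ] X) (C := 1) fun x => (one_mul ‖J x‖).ge).choose

theorem realize_of (x : X) : realize J (of J x) = J x :=
  (exists_extension J (J : X →ₗ[ℂ] X) (C := 1) fun x => (one_mul ‖J x‖).ge).choose_spec x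

theorem norm_realize (y : Extrapolated J) : ‖realize J y‖ = ‖y‖ :=
  congr_fun ((denseRange_of J).equalizer (realize J).continuous.norm continuous_norm
    (funext fun x => by
      rw [Function.comp_apply, Function.comp_apply, realize_of, norm_of])) y

theorem isometry_realize : Isometry (realize J) :=
  AddMonoidHomClass.isometry_of_norm _ (norm_realize J)

theorem isClosed_range_realize : IsClosed (range (realize J)) :=
  (isometry_realize J).isClosedEmbedding.isClosed_range

end Extrapolated

section Fractional

variable {X U : Type*} [NormedAddCommGroup X] [NormedSpace ℂ X] [CompleteSpace X]
  [NormedAddCommGroup U] [NormedSpace ℂ U] {A : X →ₗ.[ℂ] X} {s : ℂ} {φ α : ℝ}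
  {B : U →L[ℂ] ExtrapolationSpace A s}

/-- The operator b stands for (-A)^{-α} B. On X_{-α} both sides are continuous extensions of x ↦
R(s, A) (-A)^{-α} x, so they agree by density. -/
theorem MapsBoundedlyIntoFractional.exists_realize (h : MapsBoundedlyIntoFractional A s B φ α)
    (hcomm : Commute (negFracPow A φ α) (A.resolvent s)) :
    ∃ b : U →L[ℂ] X, ∀ u, A.resolvent s (b u) =
      negFracPow A φ α (Extrapolated.realize (A.resolvent s) (B u)) := by
  obtain ⟨ι, hι, B', hB'⟩ := h
  refine ⟨Extrapolated.realize (negFracPow A φ α) ∘L B', fun u => ?_⟩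
  rw [← hB' u]
  refine Extrapolated.ext_of
    (f := A.resolvent s ∘L Extrapolated.realize (negFracPow A φ α))
    (g := negFracPow A φ α ∘L Extrapolated.realize (A.resolvent s) ∘L ι) (fun x => ?_) (B' u)
  simp only [ContinuousLinearMap.comp_apply]
  rw [hι, Extrapolated.realize_of, Extrapolated.realize_of]
  exact (congr_arg (fun S : X →L[ℂ] X => S x) hcomm.eq).symm

/-- The factorization of R(s, A) through (-A)^{-α} makes the embedding ι exist; the range condition
lifts b isometrically to X_{-α}, and injectivity of (-A)^{-α} identifies the lift with B. -/
theorem MapsBoundedlyIntoFractional.of_realize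
    (hcomm : Commute (negFracPow A φ α) (A.resolvent s))
    (hinj : Function.Injective (negFracPow A φ α)) {L : X →L[ℂ] X}
    (hL : A.resolvent s = L * negFracPow A φ α) (b : U →L[ℂ] X)
    (hb : ∀ u, A.resolvent s (b u) =
      negFracPow A φ α (Extrapolated.realize (A.resolvent s) (B u)))
    (hmem : ∀ u, b u ∈ range (Extrapolated.realize (negFracPow A φ α))) :
    MapsBoundedlyIntoFractional A s B φ α := by
  obtain ⟨ι, hι⟩ := Extrapolated.exists_extension (negFracPow A φ α)
    (Extrapolated.of (A.resolvent s) : X →ₗ[ℂ] Extrapolated (A.resolvent s)) (C := ‖L‖)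
    fun x => by
      change ‖Extrapolated.of (A.resolvent s) x‖ ≤ _
      rw [Extrapolated.norm_of, hL]
      exact L.le_opNorm _
  obtain ⟨B', hB'⟩ := ContinuousLinearMap.exists_lift
    (Extrapolated.isometry_realize (negFracPow A φ α)).injective b (C := ‖b‖) fun u => by
      obtain ⟨y, hy⟩ := hmem u
      refine ⟨y, hy, ?_⟩
      rw [← Extrapolated.norm_realize, hy]
      exact b.le_opNorm u
  refine ⟨ι, hι, B', fun u => ?_⟩
  refine (Extrapolated.isometry_realize (A.resolvent s)).injective (hinj ?_)
  rw [← hb, ← hB']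
  refine (Extrapolated.ext_of
    (f := A.resolvent s ∘L Extrapolated.realize (negFracPow A φ α))
    (g := negFracPow A φ α ∘L Extrapolated.realize (A.resolvent s) ∘L ι) (fun x => ?_) (B' u)).symm
  simp only [ContinuousLinearMap.comp_apply]
  rw [hι, Extrapolated.realize_of]
  change _ = negFracPow A φ α (Extrapolated.realize _ (Extrapolated.of _ x))
  rw [Extrapolated.realize_of]
  exact (congr_arg (fun S : X →L[ℂ] X => S x) hcomm.eq).symm

end Fractional

namespace C0Semigroup

variable {X : Type*} [NormedAddCommGroup X] [NormedSpace ℂ X] [CompleteSpace X]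

theorem realize_extrapolated (T : C0Semigroup X) (s : ℂ) {t : ℝ} (ht : 0 ≤ t)
    (y : ExtrapolationSpace T.generator s) :
    Extrapolated.realize (T.generator.resolvent s) (T.extrapolated s t y) =
      T t (Extrapolated.realize (T.generator.resolvent s) y) := by
  refine Extrapolated.ext_of
    (f := Extrapolated.realize (T.generator.resolvent s) ∘L T.extrapolated s t)
    (g := T t ∘L Extrapolated.realize (T.generator.resolvent s)) (fun x => ?_) y
  simp only [ContinuousLinearMap.comp_apply]
  rw [extrapolated, dif_pos ht, Extrapolated.extendOp_of, Extrapolated.realize_of,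
    Extrapolated.realize_of]
  exact T.resolvent_comm s ht x

end C0Semigroup

/-! ### The factorization of T(t) through the fractional power -/

theorem Commute.integral_right {E : Type*} [NormedRing E] [NormedAlgebra ℝ E] [CompleteSpace E]
    {S : E} {f : ℝ → E} {s : Set ℝ} (hs : MeasurableSet s) (hf : IntegrableOn f s)
    (h : ∀ t ∈ s, Commute S (f t)) : Commute S (∫ t in s, f t) := by
  change S * _ = _ * S
  rw [← integral_const_mul_of_integrable hf, ← integral_mul_const_of_integrable hf]
  exact setIntegral_congr_fun hs fun t ht => (h t ht).eq

theorem integral_rpow_neg_div_add {t : ℝ} (ht : 0 < t) (α : ℝ) :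
    ∫ s in Ioi (0 : ℝ), s ^ (-α) / (t + s) =
      t ^ (-α) * ∫ r in Ioi (0 : ℝ), r ^ (-α) / (1 + r) := by
  have h1 := integral_comp_mul_left_Ioi (fun s : ℝ => s ^ (-α) / (t + s)) 0 ht
  rw [mul_zero, smul_eq_mul, eq_inv_mul_iff_mul_eq₀ ht.ne'] at h1
  rw [← h1, ← integral_const_mul, ← integral_const_mul]
  refine setIntegral_congr_fun measurableSet_Ioi fun r hr => ?_
  have hr' : 0 < r := hr
  rw [Real.mul_rpow ht.le hr'.le]
  field_simp

theorem integrableOn_rpow_neg_div_add {t α : ℝ} (ht : 0 < t) (h0 : 0 < α) (h1 : α < 1) :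
    IntegrableOn (fun s : ℝ => s ^ (-α) / (t + s)) (Ioi 0) := by
  refine .of_integral_ne_zero ?_
  rw [integral_rpow_neg_div_add ht]
  refine mul_ne_zero (by positivity) (ne_of_gt ?_)
  rw [setIntegral_pos_iff_support_of_nonneg_ae]
  · refine lt_of_lt_of_le ?_ (measure_mono (s := Ioi (0 : ℝ)) fun r hr => ⟨?_, hr⟩)
    · simp
    · have hr' : 0 < r := hr
      exact ne_of_gt (by positivity)
  · exact (ae_restrict_iff' measurableSet_Ioi).2 (Eventually.of_forall fun r hr => by
      have hr' : 0 < r := hr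
      simp only [Pi.zero_apply]
      positivity)
  · exact integrableOn_rpow_neg_div_one_add h0 h1

namespace C0Semigroup.IsAnalyticExtension

variable {X : Type*} [NormedAddCommGroup X] [NormedSpace ℂ X] [CompleteSpace X]
  {T : C0Semigroup X} {θ : ℝ} {F : ℂ → X →L[ℂ] X}

/-- Since T'(t) T(r) = T'(t + r), the norm is at most C ∫ r^{-α}/(t + r) dr, which equals a constant
times t^{-α} by the scaling r ↦ t r. -/
theorem exists_norm_deriv_mul_integral_le (h : T.IsAnalyticExtension θ F)
    (hT : T.IsExponentiallyStable) {α : ℝ} (hα : α ∈ Ioo (0 : ℝ) 1) :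
    ∃ C : ℝ, 0 < C ∧ ∀ t : ℝ, 0 < t →
      ‖deriv F t * ∫ r in Ioi (0 : ℝ), r ^ (-α) • T r‖ ≤ C * t ^ (-α) := by
  obtain ⟨C, hC0, hC⟩ := h.exists_norm_deriv_le hT
  set κ := ∫ r in Ioi (0 : ℝ), r ^ (-α) / (1 + r) with hκ
  have hκ0 : 0 ≤ κ := setIntegral_nonneg measurableSet_Ioi fun r hr => by
    have hr' : 0 < r := hr
    positivity
  refine ⟨C * κ + 1, by positivity, fun t ht => ?_⟩
  rw [← integral_const_mul_of_integrable
    (h.integrableOn_rpow_smul hT (a := -α) (by linarith [hα.2]))]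
  calc _ ≤ ∫ r in Ioi (0 : ℝ), C * (r ^ (-α) / (t + r)) := by
        refine norm_integral_le_of_norm_le
          ((integrableOn_rpow_neg_div_add ht hα.1 hα.2).const_mul C)
          ((ae_restrict_iff' measurableSet_Ioi).2 (Eventually.of_forall fun r hr => ?_))
        have hr' : 0 < r := hr
        rw [mul_smul_comm, ← h.deriv_add ht hr'.le, norm_smul, Real.norm_of_nonneg (by positivity)]
        calc _ ≤ r ^ (-α) * (C / (t + r)) := by
              gcongr
              exact hC _ (by positivity)
          _ = _ := by ring
    _ = C * κ * t ^ (-α) := by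
        rw [integral_const_mul, integral_rpow_neg_div_add ht]
        ring
    _ ≤ _ := by
        gcongr
        linarith

/-- The factorization `T(t) = V(t) (-A)^{-α}` and its consequences. -/
theorem exists_factorization (h : T.IsAnalyticExtension θ F) (hT : T.IsExponentiallyStable)
    {φ : ℝ} (hφ : φ ∈ Ioc (Real.pi / 2 - θ) (Real.pi / 2))
    (hσ : (-T.generator).spectrumSet ⊆ openSector φ)
    (h0 : (0 : ℂ) ∈ T.generator.resolventSet) {α : ℝ} (hα : α ∈ Ioo (0 : ℝ) 1) :
    ∃ K : X →L[ℂ] X, K * negFracPow T.generator φ α = T.generator.resolvent 0 ∧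
      (∀ z, Commute (T.generator.resolvent z) K) ∧
      ∃ C : ℝ, 0 < C ∧ ∀ t : ℝ, 0 < t → ‖deriv F t * K‖ ≤ C * t ^ (-α) := by
  obtain ⟨c, hc, hcJ⟩ := h.negFracPow_eq_integral hT hφ hσ hα
  obtain ⟨c', hc', hG⟩ := h.integral_mul_integral hT h0 hα
  obtain ⟨C, hC0, hC⟩ := h.exists_norm_deriv_mul_integral_le hT hα
  -- This is the complementary power (-A)^{-(1-α)}, normalized so that K (-A)^{-α} = (-A)^{-1}.
  refine ⟨(c * c')⁻¹ • ∫ r in Ioi (0 : ℝ), r ^ (-α) • T r, ?_, fun z => ?_,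
    ‖(c * c')⁻¹‖ * C, mul_pos (norm_pos_iff.2 (inv_ne_zero (mul_ne_zero hc hc'))) hC0, fun t ht => ?_⟩
  · rw [hcJ, smul_mul_smul_comm, hG, smul_smul, mul_assoc, inv_mul_cancel₀ (mul_ne_zero hc hc'),
      one_smul]
  · refine Commute.smul_right (Commute.integral_right measurableSet_Ioi
      (h.integrableOn_rpow_smul hT (by linarith [hα.2])) fun t ht => ?_) _
    exact (T.resolvent_commute z (le_of_lt ht)).smul_right _
  · rw [mul_smul_comm, norm_smul, mul_assoc]
    gcongr
    exact hC t ht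

theorem commute_negFracPow (h : T.IsAnalyticExtension θ F) (hT : T.IsExponentiallyStable)
    {φ : ℝ} (hφ : φ ∈ Ioc (Real.pi / 2 - θ) (Real.pi / 2))
    (hσ : (-T.generator).spectrumSet ⊆ openSector φ) {α : ℝ} (hα : α ∈ Ioo (0 : ℝ) 1)
    {S : X →L[ℂ] X} (hS : ∀ t : ℝ, 0 ≤ t → Commute S (T t)) :
    Commute S (negFracPow T.generator φ α) := by
  obtain ⟨c, hc, hcJ⟩ := h.negFracPow_eq_integral hT hφ hσ hα
  rw [hcJ]
  refine Commute.smul_right (Commute.integral_right measurableSet_Ioi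
    (h.integrableOn_rpow_smul hT (by linarith [hα.1])) fun t ht => ?_) _
  exact (hS t (le_of_lt ht)).smul_right _

end C0Semigroup.IsAnalyticExtension

/-! ### The two implications for a single pair of exponents -/

theorem memLp_sub_rpow {t a : ℝ} (ht : 0 ≤ t) {p : ℝ≥0∞} (hp0 : p ≠ 0) (hp : p ≠ ∞)
    (ha : -1 < a * p.toReal) :
    MemLp (fun r : ℝ => (t - r) ^ a) p (volume.restrict (Icc 0 t)) := by
  have hmeas : Measurable fun r : ℝ => (t - r) ^ a := by fun_prop
  rw [← integrable_norm_rpow_iff hmeas.aestronglyMeasurable hp0 hp]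
  have h1 : IntegrableOn (fun r : ℝ => (t - r) ^ (a * p.toReal)) (Icc 0 t) := by
    rw [integrableOn_Icc_iff_integrableOn_Ioc, ← intervalIntegrable_iff_integrableOn_Ioc_of_le ht]
    have h2 : IntervalIntegrable (fun r : ℝ => r ^ (a * p.toReal)) volume t 0 :=
      intervalIntegral.intervalIntegrable_rpow' ha
    simpa using h2.comp_sub_left t
  refine h1.congr ((ae_restrict_iff' measurableSet_Icc).2 (Eventually.of_forall fun r hr => ?_))
  have h3 : 0 ≤ t - r := by linarith [hr.2]
  simp only
  rw [Real.norm_of_nonneg (by positivity), Real.rpow_mul h3]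

namespace C0Semigroup.IsAnalyticExtension

variable {X : Type*} [NormedAddCommGroup X] [NormedSpace ℂ X] [CompleteSpace X]
  {U : Type*} [NormedAddCommGroup U] [NormedSpace ℂ U]
  {T : C0Semigroup X} {θ : ℝ} {F : ℂ → X →L[ℂ] X} {s : ℂ}
  {B : U →L[ℂ] ExtrapolationSpace T.generator s}

/-- An operator with values in a fractional extrapolation space is admissible: `V` plays the role
of `t ↦ T(t)` on that space. -/
theorem isFiniteTimeAdmissible_of_norm_le {α : ℝ} {p q : ℝ≥0∞} (hpq : q.HolderTriple p 1) (hq0 : q ≠ 0) (hq : q ≠ ∞)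
    (hα : α * q.toReal < 1) {V : ℝ → X →L[ℂ] X} (hV : ContinuousOn V (Ioi 0)) {C : ℝ} (hC0 : 0 < C)
    (hC : ∀ t : ℝ, 0 < t → ‖V t‖ ≤ C * t ^ (-α)) (b : U →L[ℂ] X)
    (hVb : ∀ t : ℝ, 0 < t → ∀ u, T.generator.resolvent s (V t (b u)) =
      T t (Extrapolated.realize (T.generator.resolvent s) (B u))) :
    T.IsFiniteTimeAdmissible s B p := by
  intro t ht
  set μ := volume.restrict (Icc 0 t) with hμ
  set w : ℝ → ℝ := fun r => (t - r) ^ (-α) with hw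
  have hwq : MemLp w q μ := memLp_sub_rpow ht hq0 hq (by rw [neg_mul]; linarith)
  set κ := (eLpNorm w q μ).toReal with hκ
  -- The endpoint r = t is a null set and is dropped, since V is controlled only at positive times.
  have hae : ∀ {P : ℝ → Prop}, (∀ r ∈ Ico 0 t, P r) → ∀ᵐ r ∂μ, P r := fun {P} hP => by
    rw [hμ, ← restrict_Ico_eq_restrict_Icc]
    exact (ae_restrict_iff' measurableSet_Ico).2 (Eventually.of_forall hP)
  -- The summand 1 only makes the constant strictly positive, e.g. when t = 0 or b = 0.
  refine ⟨C * ‖b‖ * κ + 1, by positivity, fun u hu => ?_⟩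
  have hg1 : MemLp (w • u) 1 μ := hu.smul hwq
  have hfmeas : AEStronglyMeasurable (fun r => V (t - r) (b (u r))) μ := by
    have h1 : AEStronglyMeasurable (fun r => V (t - r)) μ := by
      rw [hμ, ← restrict_Ico_eq_restrict_Icc]
      refine ContinuousOn.aestronglyMeasurable ?_ measurableSet_Ico
      exact hV.comp (Continuous.continuousOn (by fun_prop)) fun r hr => sub_pos.2 hr.2
    have h2 : AEStronglyMeasurable (fun r => b (u r)) μ :=
      b.continuous.comp_aestronglyMeasurable hu.1
    exact isBoundedBilinearMap_apply.continuous.comp_aestronglyMeasurable (h1.prodMk h2)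
  have hfle : ∀ᵐ r ∂μ, ‖V (t - r) (b (u r))‖ ≤ C * ‖b‖ * ‖(w • u) r‖ := hae fun r hr => by
    have h3 : 0 < t - r := sub_pos.2 hr.2
    rw [Pi.smul_apply', norm_smul, hw, Real.norm_of_nonneg (by positivity)]
    calc ‖V (t - r) (b (u r))‖ ≤ C * (t - r) ^ (-α) * (‖b‖ * ‖u r‖) :=
          ContinuousLinearMap.le_of_opNorm_le_of_le _ (hC _ h3) (b.le_opNorm _)
      _ = _ := by ring
  have hgint : Integrable (w • u) μ := memLp_one_iff_integrable.1 hg1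
  have hfint : Integrable (fun r => V (t - r) (b (u r))) μ :=
    Integrable.mono' (hgint.norm.const_mul (C * ‖b‖)) hfmeas hfle
  have heq : (fun r => Extrapolated.of (T.generator.resolvent s) (V (t - r) (b (u r)))) =ᵐ[μ]
      fun r => T.extrapolated s (t - r) (B (u r)) := hae fun r hr => by
    refine (Extrapolated.isometry_realize (T.generator.resolvent s)).injective ?_
    rw [Extrapolated.realize_of, T.realize_extrapolated s (sub_nonneg.2 hr.2.le),
      hVb _ (sub_pos.2 hr.2)]
  refine ⟨((Extrapolated.of (T.generator.resolvent s)).integrable_comp hfint).congr heq,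
    ∫ r, V (t - r) (b (u r)) ∂μ, ?_, ?_⟩
  · rw [← ContinuousLinearMap.integral_comp_comm _ hfint]
    exact integral_congr_ae heq
  · have h4 : ∫ r, ‖(w • u) r‖ ∂μ ≤ κ * (eLpNorm u p μ).toReal := by
      rw [integral_norm_eq_lintegral_enorm hg1.1, ← eLpNorm_one_eq_lintegral_enorm, hκ,
        ← ENNReal.toReal_mul]
      exact ENNReal.toReal_mono
        (ENNReal.mul_ne_top hwq.eLpNorm_lt_top.ne hu.eLpNorm_lt_top.ne)
        (eLpNorm_smul_le_mul_eLpNorm hu.1 hwq.1)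
    calc _ ≤ ∫ r, C * ‖b‖ * ‖(w • u) r‖ ∂μ :=
          norm_integral_le_of_norm_le (hgint.norm.const_mul _) hfle
      _ = C * ‖b‖ * ∫ r, ‖(w • u) r‖ ∂μ := integral_const_mul _ _
      _ ≤ C * ‖b‖ * (κ * (eLpNorm u p μ).toReal) := by gcongr
      _ = C * ‖b‖ * κ * (eLpNorm u p μ).toReal := by ring
      _ ≤ _ := by
        gcongr
        linarith

/-- Take V(t) = -T'(t) K, so that T(t) = V(t) (-A)^{-α}. As R(s, A) commutes with V(t), the element
V(t) b u of X represents T(t) B u in X_{-1}. -/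
theorem isFiniteTimeAdmissible_of_mapsBoundedlyIntoFractional (h : T.IsAnalyticExtension θ F)
    (hT : T.IsExponentiallyStable) {φ : ℝ} (hφ : φ ∈ Ioc (Real.pi / 2 - θ) (Real.pi / 2))
    (hσ : (-T.generator).spectrumSet ⊆ openSector φ) (h0 : (0 : ℂ) ∈ T.generator.resolventSet)
    {α : ℝ} (hα : α ∈ Ioo (0 : ℝ) 1) {p q : ℝ≥0∞}
    (hpq : q.HolderTriple p 1) (hq0 : q ≠ 0) (hq : q ≠ ∞) (hαq : α * q.toReal < 1)
    (hB : MapsBoundedlyIntoFractional T.generator s B φ α) : T.IsFiniteTimeAdmissible s B p := by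
  obtain ⟨K, hKJ, hKR, C, hC0, hC⟩ := h.exists_factorization hT hφ hσ h0 hα
  have hJR : Commute (T.generator.resolvent s) (negFracPow T.generator φ α) :=
    h.commute_negFracPow hT hφ hσ hα fun t ht => T.resolvent_commute s ht
  obtain ⟨b, hb⟩ := hB.exists_realize hJR.symm
  have hRD : ∀ z, ∀ t : ℝ, 0 < t → Commute (T.generator.resolvent z) (deriv F t) := fun z t ht =>
    h.commute_deriv (fun r hr => T.resolvent_commute z hr) ht
  refine isFiniteTimeAdmissible_of_norm_le hpq hq0 hq hαq (V := fun t => -(deriv F t * K))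
    (h.continuousOn_deriv.mul continuousOn_const).neg hC0 (fun t ht => by
      rw [norm_neg]
      exact hC t ht) b fun t ht u => ?_
  have h1 : T.generator.resolvent s * -(deriv F t * K) = -(deriv F t * K) * T.generator.resolvent s :=
    (((hRD s t ht).mul_right (hKR s)).neg_right).eq
  have h2 : -(deriv F t * K) * negFracPow T.generator φ α = T t := by
    rw [neg_mul, mul_assoc, hKJ, ← (hRD 0 t ht).eq,
      ← h.eq_neg_resolvent_mul_deriv_ofReal h0 ht]
  calc T.generator.resolvent s ((-(deriv F t * K)) (b u))
      = (-(deriv F t * K)) (T.generator.resolvent s (b u)) :=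
        congr_arg (fun S : X →L[ℂ] X => S (b u)) h1
    _ = (-(deriv F t * K) * negFracPow T.generator φ α)
          (Extrapolated.realize (T.generator.resolvent s) (B u)) := by rw [hb]; rfl
    _ = _ := by rw [h2]

/-- The smoothing effect of the semigroup gives the integrals away from zero. -/
theorem exists_resolvent_mul_eq_integral_Ioi_one (h : T.IsAnalyticExtension θ F)
    (hT : T.IsExponentiallyStable) (h0 : (0 : ℂ) ∈ T.generator.resolventSet) {L : X →L[ℂ] X}
    (hL : T.generator.resolvent s * L = T.generator.resolvent 0) {α : ℝ} (hα : α < 1) :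
    ∃ W : X →L[ℂ] X,
      T.generator.resolvent s * W = ∫ t in Ioi (1 : ℝ), t ^ (α - 1) • T t := by
  obtain ⟨C, hC0, hC⟩ := h.exists_norm_deriv_le hT
  have hint : IntegrableOn (fun t : ℝ => t ^ (α - 1) • deriv F t) (Ioi 1) := by
    refine Integrable.mono'
      ((integrableOn_Ioi_rpow_of_lt (by linarith : α - 1 - 1 < -1) one_pos).const_mul C) ?_ ?_
    · refine ContinuousOn.aestronglyMeasurable ?_ measurableSet_Ioi
      refine ContinuousOn.smul (continuousOn_id.rpow_const fun r hr => Or.inl ?_)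
        (h.continuousOn_deriv.mono (Ioi_subset_Ioi zero_le_one))
      exact ne_of_gt (one_pos.trans hr)
    · refine (ae_restrict_iff' measurableSet_Ioi).2 (Eventually.of_forall fun t ht => ?_)
      have ht' : 0 < t := one_pos.trans ht
      rw [norm_smul, Real.norm_of_nonneg (by positivity), Real.rpow_sub_one (x := t) ht'.ne' (α - 1)]
      calc _ ≤ t ^ (α - 1) * (C / t) := by
            gcongr
            exact hC t ht'
        _ = _ := by ring
  -- For t > 1, T(t) = -R(s, A) L T'(t); the integral of t^{α-1} T'(t) converges since ‖T'(t)‖ ≤ C/t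
  -- and α < 1.
  refine ⟨-(L * ∫ t in Ioi (1 : ℝ), t ^ (α - 1) • deriv F t), ?_⟩
  rw [mul_neg, ← mul_assoc, hL, ← integral_const_mul_of_integrable hint, ← integral_neg]
  refine setIntegral_congr_fun measurableSet_Ioi fun t ht => ?_
  rw [mul_smul_comm, ← smul_neg, ← h.eq_neg_resolvent_mul_deriv_ofReal h0 (one_pos.trans ht)]

/-- Admissibility at time 1 is tested on r ↦ (1 - r)^{α-1} u, which is in L^p because p(1-α) < 1;
the substitution t = 1 - r produces the Mellin integrand. -/
theorem exists_resolvent_eq_integral_Ioc (h : T.IsAnalyticExtension θ F)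
    (hT : T.IsExponentiallyStable) {α p : ℝ} (hα : α ∈ Ioo (0 : ℝ) 1) (hp : 0 < p)
    (hαp : p * (1 - α) < 1) (hB : T.IsFiniteTimeAdmissible s B (ENNReal.ofReal p)) :
    ∃ C : ℝ, ∀ u, ∃ x, T.generator.resolvent s x =
      (∫ t in Ioc (0 : ℝ) 1, t ^ (α - 1) • T t)
        (Extrapolated.realize (T.generator.resolvent s) (B u)) ∧ ‖x‖ ≤ C * ‖u‖ := by
  obtain ⟨C, hC0, hC⟩ := hB 1 zero_le_one
  set w : ℝ → ℝ := fun r => (1 - r) ^ (α - 1) with hw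
  have hwp : MemLp w (ENNReal.ofReal p) (volume.restrict (Icc 0 1)) := by
    refine memLp_sub_rpow zero_le_one (by simpa using hp) ENNReal.ofReal_ne_top ?_
    rw [ENNReal.toReal_ofReal hp.le]
    linarith
  refine ⟨C * (eLpNorm w (ENNReal.ofReal p) (volume.restrict (Icc 0 1))).toReal, fun u => ?_⟩
  have hle : ∀ᵐ r ∂(volume.restrict (Icc (0 : ℝ) 1)), ‖w r • u‖ ≤ ‖u‖ * ‖w r‖ :=
    Eventually.of_forall fun r => by rw [norm_smul, mul_comm]
  have hu : MemLp (fun r => w r • u) (ENNReal.ofReal p) (volume.restrict (Icc 0 1)) :=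
    hwp.of_le_mul (hwp.1.smul_const u) hle
  obtain ⟨hint, x, hx, hxC⟩ := hC _ hu
  refine ⟨x, ?_, hxC.trans ?_⟩
  · have h1 := congr_arg (Extrapolated.realize (T.generator.resolvent s)) hx
    rw [Extrapolated.realize_of, ← ContinuousLinearMap.integral_comp_comm _ hint] at h1
    rw [h1, integral_Icc_eq_integral_Ioc, ← intervalIntegral.integral_of_le zero_le_one,
      ContinuousLinearMap.integral_apply ((h.integrableOn_rpow_smul hT
        (by linarith [hα.1] : -1 < α - 1)).mono_set Ioc_subset_Ioi_self),
      ← intervalIntegral.integral_of_le zero_le_one]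
    have h2 := intervalIntegral.integral_comp_sub_left (a := 0) (b := 1) (fun t : ℝ =>
      (t ^ (α - 1) • T t) (Extrapolated.realize (T.generator.resolvent s) (B u))) 1
    rw [sub_self, sub_zero] at h2
    rw [← h2]
    refine intervalIntegral.integral_congr fun r hr => ?_
    rw [uIcc_of_le zero_le_one] at hr
    rw [T.realize_extrapolated s (by linarith [hr.2])]
    exact (T (1 - r) ∘L Extrapolated.realize (T.generator.resolvent s) ∘L B).map_smul_of_tower
      ((1 - r) ^ (α - 1)) u
  · have h3 : (eLpNorm (fun r => w r • u) (ENNReal.ofReal p) (volume.restrict (Icc 0 1))).toReal ≤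
        ‖u‖ * (eLpNorm w (ENNReal.ofReal p) (volume.restrict (Icc 0 1))).toReal := by
      rw [← ENNReal.toReal_ofReal (norm_nonneg u), ← ENNReal.toReal_mul]
      exact ENNReal.toReal_mono
        (ENNReal.mul_ne_top ENNReal.ofReal_ne_top hwp.eLpNorm_lt_top.ne)
        (eLpNorm_le_mul_eLpNorm_of_ae_le_mul hle _)
    calc _ ≤ C * (‖u‖ * (eLpNorm w (ENNReal.ofReal p) (volume.restrict (Icc 0 1))).toReal) := by
          gcongr
      _ = _ := by ring

/-- The Mellin integral is split at 1: admissibility handles (0, 1], smoothing handles (1, ∞), and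
together they make b = (-A)^{-α} B bounded into X. Strong continuity then places b u in the closed
range of `Extrapolated.realize`. -/
theorem mapsBoundedlyIntoFractional_of_isFiniteTimeAdmissible (h : T.IsAnalyticExtension θ F)
    (hT : T.IsExponentiallyStable) {φ : ℝ} (hφ : φ ∈ Ioc (Real.pi / 2 - θ) (Real.pi / 2))
    (hσ : (-T.generator).spectrumSet ⊆ openSector φ) (h0 : (0 : ℂ) ∈ T.generator.resolventSet)
    (hs : s ∈ T.generator.resolventSet) {α p : ℝ} (hα : α ∈ Ioo (0 : ℝ) 1) (hp : 0 < p)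
    (hαp : p * (1 - α) < 1) (hB : T.IsFiniteTimeAdmissible s B (ENNReal.ofReal p)) :
    MapsBoundedlyIntoFractional T.generator s B φ α := by
  obtain ⟨K, hKJ, -⟩ := h.exists_factorization hT hφ hσ h0 hα
  obtain ⟨c, hc, hcJ⟩ := h.negFracPow_eq_integral hT hφ hσ hα
  have hinj := LinearPMap.resolvent_injective hs
  have hJR : Commute (T.generator.resolvent s) (negFracPow T.generator φ α) :=
    h.commute_negFracPow hT hφ hσ hα fun t ht => T.resolvent_commute s ht
  have hJinj : Function.Injective (negFracPow T.generator φ α) := by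
    refine Function.Injective.of_comp (f := K) ?_
    have h1 := LinearPMap.resolvent_injective h0
    rw [← hKJ] at h1
    exact h1
  -- Here 1 + s R(0, A) = (s - A)(-A)^{-1}, so R(s, A) cancels the first factor.
  have hLs : T.generator.resolvent s * (1 + s • T.generator.resolvent 0) =
      T.generator.resolvent 0 := by
    have h1 := LinearPMap.resolvent_sub_resolvent hs h0
    rw [zero_sub, neg_smul] at h1
    rw [mul_add, mul_one, mul_smul_comm]
    rw [sub_eq_iff_eq_add] at h1
    nth_rw 1 [h1]
    abel
  have hL0 : T.generator.resolvent s =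
      ((1 - s • T.generator.resolvent s) * K) * negFracPow T.generator φ α := by
    have h1 := LinearPMap.resolvent_sub_resolvent hs h0
    rw [zero_sub, neg_smul] at h1
    rw [mul_assoc, hKJ, sub_mul, one_mul, smul_mul_assoc, sub_eq_add_neg, ← h1]
    abel
  set L := 1 + s • T.generator.resolvent 0 with hL
  obtain ⟨W, hW⟩ := h.exists_resolvent_mul_eq_integral_Ioi_one hT h0 hLs hα.2
  obtain ⟨C, hC⟩ := h.exists_resolvent_eq_integral_Ioc hT hα hp hαp hB
  set E : U →L[ℂ] X := Extrapolated.realize (T.generator.resolvent s) ∘L B with hE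
  have hsplit : (∫ t in Ioi (0 : ℝ), t ^ (α - 1) • T t) =
      (∫ t in Ioc (0 : ℝ) 1, t ^ (α - 1) • T t) + ∫ t in Ioi (1 : ℝ), t ^ (α - 1) • T t := by
    have h1 := h.integrableOn_rpow_smul hT (by linarith [hα.1] : -1 < α - 1)
    rw [← Ioc_union_Ioi_eq_Ioi zero_le_one, setIntegral_union (Ioc_disjoint_Ioi le_rfl)
      measurableSet_Ioi (h1.mono_set Ioc_subset_Ioi_self)
      (h1.mono_set (Ioi_subset_Ioi zero_le_one))]
  obtain ⟨b, hb⟩ := ContinuousLinearMap.exists_lift hinj (negFracPow T.generator φ α ∘L E)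
    (C := ‖c‖ * (C + ‖W‖ * ‖E‖)) fun u => by
      obtain ⟨x, hx, hxC⟩ := hC u
      refine ⟨c • (x + W (E u)), ?_, ?_⟩
      · rw [map_smul, _root_.map_add, hx]
        have h1 : T.generator.resolvent s (W (E u)) =
            (∫ t in Ioi (1 : ℝ), t ^ (α - 1) • T t) (E u) := by rw [← hW]; rfl
        rw [h1, ContinuousLinearMap.comp_apply, hcJ, hsplit]
        rfl
      · rw [norm_smul, mul_assoc, add_mul]
        gcongr
        refine (norm_add_le _ _).trans (add_le_add hxC ?_)
        rw [mul_assoc]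
        exact W.le_opNorm_of_le (E.le_opNorm u)
  refine MapsBoundedlyIntoFractional.of_realize hJR.symm hJinj hL0 b hb fun u => ?_
  refine (Extrapolated.isClosed_range_realize _).mem_of_tendsto (T.tendsto_zero (b u)) ?_
  filter_upwards [self_mem_nhdsWithin] with t ht
  have ht' : 0 < t := ht
  -- The witness is T(t) B u as an element of X: T(t) = -R(s, A) L T'(t) removes the factor R(s, A)
  -- carried by the realization of B u.
  refine ⟨Extrapolated.of _ (-(L (deriv F t (E u)))), ?_⟩
  rw [Extrapolated.realize_of]
  refine hinj ?_
  have hJT : Commute (T t) (negFracPow T.generator φ α) :=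
    h.commute_negFracPow hT hφ hσ hα fun r hr => by
      change _ * _ = _ * _
      rw [T.mul_eq ht'.le hr, T.mul_eq hr ht'.le, add_comm]
  calc T.generator.resolvent s (negFracPow T.generator φ α (-(L (deriv F t (E u)))))
      = negFracPow T.generator φ α (T.generator.resolvent s (-(L (deriv F t (E u))))) :=
        congr_arg (fun S : X →L[ℂ] X => S (-(L (deriv F t (E u))))) hJR.eq
    _ = negFracPow T.generator φ α (T t (E u)) := by
        congr 1
        rw [h.eq_neg_resolvent_mul_deriv_ofReal h0 ht', ← hLs, map_neg]
        rfl
    _ = T t (negFracPow T.generator φ α (E u)) :=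
        (congr_arg (fun S : X →L[ℂ] X => S (E u)) hJT.eq).symm
    _ = T t (T.generator.resolvent s (b u)) := by rw [hb]; rfl
    _ = T.generator.resolvent s (T t (b u)) := (T.resolvent_comm s ht'.le (b u)).symm

end C0Semigroup.IsAnalyticExtension

/-! ### The equivalence: choice of exponents -/

theorem mainTheorem1 {X : Type*} [NormedAddCommGroup X] [NormedSpace ℂ X] [CompleteSpace X]
    {U : Type*} [NormedAddCommGroup U] [NormedSpace ℂ U] [CompleteSpace U]
    (T : C0Semigroup X) (hstab : T.IsExponentiallyStable)
    (θ : ℝ) (hT : T.IsAnalyticOfAngle θ)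
    (φ : ℝ) (hφ : φ ∈ Ioc (Real.pi / 2 - θ) (Real.pi / 2))
    (hσ : (-T.generator).spectrumSet ⊆ openSector φ)
    (s : ℂ) (hs : s ∈ T.generator.resolventSet)
    (B : U →L[ℂ] ExtrapolationSpace T.generator s)
    (β : ℝ) (hβ : β ∈ Ioo (0 : ℝ) 1) :
    (∀ p : ℝ≥0∞, ENNReal.ofReal (1 / (1 - β)) < p → T.IsFiniteTimeAdmissible s B p) ↔
      ∀ α ∈ Ioo β 1, MapsBoundedlyIntoFractional T.generator s B φ α := by
  obtain ⟨hθ0, hθ1, F, hF1, hF2, hF3⟩ := hT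
  have h : T.IsAnalyticExtension θ F := ⟨hθ0, hθ1, hF1, hF2, hF3⟩
  have hφ0 : 0 < φ := by linarith [hφ.1]
  have h0 : (0 : ℂ) ∈ T.generator.resolventSet := by
    simpa using LinearPMap.mem_resolventSet_of_spectrumSet_neg_subset
      (by linarith [hφ.2, Real.pi_pos]) hσ (le_refl (0 : ℝ)) (ψ := 0)
      (by rw [abs_zero]; linarith [hφ.2, Real.pi_pos]) hφ0
  have hβ1 : 0 < 1 - β := by linarith [hβ.2]
  constructor
  · intro hB α hα
    have hα1 : 0 < 1 - α := by linarith [hα.2]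
    -- The upper bound p < 1/(1-α) is what makes t^{α-1} p-integrable near 0.
    obtain ⟨p, hp1, hp2⟩ := exists_between
      (one_div_lt_one_div_of_lt hα1 (by linarith [hα.1] : 1 - α < 1 - β))
    have hp0 : 0 < p := (one_div_pos.2 hβ1).trans hp1
    refine h.mapsBoundedlyIntoFractional_of_isFiniteTimeAdmissible hstab hφ hσ h0 hs
      ⟨hβ.1.trans hα.1, hα.2⟩ hp0 ((lt_div_iff₀ hα1).1 hp2) (hB _ ?_)
    exact (ENNReal.ofReal_lt_ofReal_iff hp0).2 hp1
  · intro hB p hp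
    have hp1 : 1 < p := by
      refine lt_of_le_of_lt ?_ hp
      rw [← ENNReal.ofReal_one]
      refine ENNReal.ofReal_le_ofReal ?_
      rw [le_div_iff₀ hβ1]
      linarith [hβ.1]
    -- Working with p⁻¹ treats p = ∞ uniformly, with p⁻¹ = 0 and conjugate exponent 1.
    have hpinv : p⁻¹ ≤ 1 := ENNReal.inv_le_one.2 hp1.le
    have hpt : (p⁻¹).toReal < 1 - β := by
      have h1 : p⁻¹ < ENNReal.ofReal (1 - β) := by
        rw [ENNReal.inv_lt_iff_inv_lt, ← ENNReal.ofReal_inv_of_pos hβ1, ← one_div]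
        exact hp
      exact (ENNReal.toReal_lt_toReal (ne_top_of_le_ne_top ENNReal.one_ne_top hpinv)
        ENNReal.ofReal_ne_top).2 h1 |>.trans_eq (ENNReal.toReal_ofReal hβ1.le)
    -- Here 1 - 1/p = 1/q for the conjugate exponent q, so α < 1/q gives αq < 1.
    obtain ⟨α, hα1, hα2⟩ := exists_between (by linarith : β < 1 - (p⁻¹).toReal)
    have hα3 : α < 1 := by linarith [ENNReal.toReal_nonneg (a := p⁻¹)]
    have hγ : 0 < 1 - (p⁻¹).toReal := by linarith [hβ.1]
    have hconj : p.HolderConjugate (1 - p⁻¹)⁻¹ := ENNReal.HolderConjugate.inv_one_sub_inv' hp1.le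
    refine h.isFiniteTimeAdmissible_of_mapsBoundedlyIntoFractional hstab hφ hσ h0
      ⟨hβ.1.trans hα1, hα3⟩ (q := (1 - p⁻¹)⁻¹) hconj.symm ?_ ?_ ?_ (hB α ⟨hα1, hα3⟩)
    · exact hconj.symm.ne_zero
    · rw [ENNReal.inv_ne_top]
      exact (tsub_pos_of_lt (ENNReal.inv_lt_one.2 hp1)).ne'
    · rw [ENNReal.toReal_inv, ENNReal.toReal_sub_of_le hpinv ENNReal.one_ne_top,
        ENNReal.toReal_one, ← div_eq_mul_inv, div_lt_one hγ]
      exact hα2
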